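/- All structures are relational; classes consist of finite structures and contain the empty structure, and are closed under isomorphism. Let $\mathcal{F}$ be a Fraïssé class, containing a non-empty structure, in a relational signature that includes a binary symbol $<$ interpreted as a linear order on every member of $\mathcal{F}$, and let $\mathcal{F}^-$ be the class of the reducts of members of $\mathcal{F}$ obtained by removing $<$ from the signature. Call $\mathcal{F}$ a full order expansion if $\mathcal{F}$ is the class of all $(A,<)$ with $A\in\mathcal{F}^-$ and $<$ an arbitrary linear order on $A$. Say that $\mathcal{F}^-$ has free amalgamation if for all $A,B,C\in\mathcal{F}^-$ with $A\subseteq B$, $A\subseteq C$ and $B\cap C=A$ ($A=\emptyset$ allowed), the structure $B\cup C$ whose relations are exactly those of $B$ and those of $C$ (so that no related tuple involves at the same time an element of $B\setminus A$ and an element of $C\setminus A$) belongs to $\mathcal{F}^-$. For a countable structure $M$, equip $\mathrm{Aut}(M)\subseteq M^M$ with the topology of pointwise convergence ($M$ discrete). For a topological group $G$ and $(f_1,f_2)\in G^2$, the $2$-dimensional topological similarity class of $(f_1,f_2)$ is the set of all $(g_1,g_2)\in G^2$ such that the map $f_1\mapsto g_1$, $f_2\mapsto g_2$ extends to an isomorphism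 of topological groups from $\langle f_1,f_2\rangle$ onto $\langle g_1,g_2\rangle$ (with the subspace topologies). **Corollary.** Suppose that either $\mathcal{F}$ is a full order expansion such that $\mathcal{F}^-$ has free amalgamation, or $\mathcal{F}$ is the class of finite ordered tournaments, that is, of all finite tournaments equipped with an arbitrary linear order. Let $M$ be the Fraïssé limit of $\mathcal{F}$, i.e. a countable ultrahomogeneous structure whose age is $\mathcal{F}$. Then every $2$-dimensional topological similarity class in $\mathrm{Aut}(M)$ is meager in $\mathrm{Aut}(M)^2$. -/

import Mathlib

open FirstOrder CategoryTheory

universe u v w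

namespace FirstOrder.Language

section Automorphisms

variable (L : Language.{u, v}) (M : Type w) [L.Structure M]

/-- The automorphism group `Aut(M)` of a first-order structure `M`, under composition. -/
instance autGroup : Group (M ≃[L] M) where
  mul f g := f.comp g
  one := Equiv.refl L M
  inv f := f.symm
  mul_assoc _ _ _ := rfl
  one_mul _ := rfl
  mul_one _ := rfl
  inv_mul_cancel f := Equiv.symm_comp_self f

/-- The topology of pointwise convergence on `Aut(M)`: the subspace topology from the product
`M ^ M`, where `M` is regarded as a discrete space. -/
instance autTopology : TopologicalSpace (M ≃[L] M) :=
  TopologicalSpace.induced (fun f : M ≃[L] M => (f : M → M))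
    (@Pi.topologicalSpace M (fun _ => M) (fun _ => ⊥))

end Automorphisms

section Classes

variable {L : Language.{u, v}}

/-- A class `K` of structures in a relational language has *free amalgamation* if all
`B, C ∈ K` with a common substructure `A ∈ K` have an amalgam `D ∈ K` over `A` with underlying
set `B ∪ C`, where `B ∩ C = A`, such that no related tuple of `D` involves at the same time an
element of `B \ A` and an element of `C \ A`. -/
def FreeAmalgamation (K : Set (Bundled.{w} L.Structure)) : Prop :=
  ∀ (A B C : Bundled.{w} L.Structure) (f : A ↪[L] B) (g : A ↪[L] C), A ∈ K → B ∈ K → C ∈ K →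
    ∃ (D : Bundled.{w} L.Structure) (i : B ↪[L] D) (j : C ↪[L] D),
      D ∈ K ∧ i.comp f = j.comp g ∧
      Set.range i ∪ Set.range j = Set.univ ∧
      Set.range i ∩ Set.range j = Set.range (i.comp f) ∧
      ∀ (n : ℕ) (R : L.Relations n) (x : Fin n → D), Structure.RelMap R x →
        ¬ ((∃ k, x k ∈ Set.range i \ Set.range (i.comp f)) ∧
            ∃ l, x l ∈ Set.range j \ Set.range (i.comp f))

/-- The structure obtained by forgetting the order symbol. -/
def orderReduct (A : Bundled.{w} (L.sum Language.order).Structure) : Bundled.{w} L.Structure :=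
  ⟨A, (LHom.sumInl : L →ᴸ L.sum Language.order).reduct A⟩

/-- The class `F⁻` of the reducts of the members of `F`, with the order symbol removed. -/
def reductClass (F : Set (Bundled.{w} (L.sum Language.order).Structure)) :
    Set (Bundled.{w} L.Structure) :=
  orderReduct '' F

/-- The class `K * LO` of all structures `(A, ≤)`, where `A ∈ K` and `≤` is an arbitrary linear
order on `A`. -/
def orderExpansion (K : Set (Bundled.{w} L.Structure)) :
    Set (Bundled.{w} (L.sum Language.order).Structure) :=
  {A | orderReduct A ∈ K ∧ A ⊨ (L.sum Language.order).linearOrderTheory}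

/-- `F` is a *full order expansion* if `F = F⁻ * LO`. -/
def IsFullOrderExpansion (F : Set (Bundled.{w} (L.sum Language.order).Structure)) : Prop :=
  F = orderExpansion (reductClass F)

end Classes

/-- The relation symbols of the language of tournaments: a single binary symbol. -/
inductive TournamentRel : ℕ → Type
  | arrow : TournamentRel 2

/-- The language of tournaments. -/
def tournament : Language.{0, 0} := ⟨fun _ => Empty, TournamentRel⟩

instance : tournament.IsRelational := fun _ => inferInstanceAs (IsEmpty Empty)

/-- The class of finite tournaments: between any two distinct points there is exactly one arrow,
and there are no loops. -/
def finiteTournaments : Set (Bundled.{w} tournament.Structure) :=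
  {A | Finite A ∧
    (∀ x : A, ¬ Structure.RelMap (L := tournament) TournamentRel.arrow ![x, x]) ∧
    ∀ x y : A, x ≠ y →
      Xor (Structure.RelMap (L := tournament) TournamentRel.arrow ![x, y])
        (Structure.RelMap (L := tournament) TournamentRel.arrow ![y, x])}

end FirstOrder.Language

/-- The *topological similarity class* of an `n`-tuple `f` in a topological group `G`: all
`n`-tuples `g` such that `f i ↦ g i` extends to an isomorphism of topological groups between the
subgroup generated by `f` and the subgroup generated by `g`. -/
def topologicalSimilarityClass {G : Type*} [Group G] [TopologicalSpace G] {n : ℕ}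
    (f : Fin n → G) : Set (Fin n → G) :=
  {g | ∃ φ : Subgroup.closure (Set.range f) ≃ₜ* Subgroup.closure (Set.range g),
    ∀ i, (φ ⟨f i, Subgroup.subset_closure (Set.mem_range_self i)⟩ : G) = g i}

/-! Category. Let `g` be similar to `f` and let the first entry of `g` move `x`. Continuity of the
isomorphism in both directions gives finite sets `F`, `F'` such that every word fixing `F'`
pointwise under `g` fixes `F` pointwise under `f`, and every word fixing `F` under `f` fixes `x`
under `g`. For given `x`, `F`, `F'` the pairs `g` with these properties form a closed set. It has
empty interior if each basic open set, given by two finite partial automorphisms, contains for one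
word `w` a pair under which `w` fixes `F'` and a pair under which `w` moves `x`
(`isMeagre_topologicalSimilarityClass`). There are countably many such sets; the pairs with trivial
first entry are nowhere dense as well.

The word. Let `K` be the set of common fixed points of the two partial automorphisms. If a word `u`
carries the points of `F'` and `x` that lie outside `K` to places where one generator `f j` may
still be extended either by the identity or not, then `w = u⁻¹ * f j * u` works (`exists_word`). For
the order, it is enough that within its cell of `K` each point lies to the right of the domain and
range of `f j` (`exists_escape`). For the relations, it is enough that the points are related to
domain and range in one uniform generic way, except for tuples inside `K` and the points themselves
(`exists_generic`, `exists_extension_id`).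

Escape. In a cell of `K`, fixed points are inserted, none of them common, until they separate points
moved up from points moved down. Then a positive or negative power of an extension of `f j` carries
a point past everything before the next fixed point of `f j`. Since the cell has no common fixed
point, alternating the generators passes all obstacles. Escaped points in other cells keep escaping
because their images are chosen as high as possible.

Genericity. New images are generic over everything present, so relations are forced only on points
whose backward orbit stays in the domain. Such an orbit, if long, repeats, and an order-preserving
map has no finite orbit except fixed points. One block of each generator therefore leaves only `K`.

Free extensions exist because the order is arbitrary, so the cut can be prescribed, and because new
relations can be left out (free amalgamation) or directed away from the new point (tournaments). -/

section PartialAutomorphisms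

/-! ### Generic points, partial automorphisms and cells -/

variable {G M : Type*} [Group G] [MulAction G M]
variable {I : ℕ → Type*} {rel : ∀ n, I n → (Fin n → M) → Prop}
  {δ : ∀ n, I n → Set (Fin n) → Prop}

/-- The points of `E` are *generic* over `C` relative to `R`: a tuple from `C ∪ E` that meets `E` and
is not contained in `R ∪ E` satisfies a relation exactly when `δ` prescribes it for the set of
coordinates lying in `E`. -/
def GenericOver (rel : ∀ n, I n → (Fin n → M) → Prop) (δ : ∀ n, I n → Set (Fin n) → Prop)
    (E R C : Set M) : Prop :=
  ∀ (n : ℕ) (r : I n) (x : Fin n → M), (∀ k, x k ∈ C ∪ E) → (∃ k, x k ∈ E) →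
    (∃ k, x k ∉ R ∪ E) → (rel n r x ↔ δ n r {k | x k ∈ E})

theorem GenericOver.mono {E R R' C C' : Set M} (h : GenericOver rel δ E R C) (hR : R ⊆ R')
    (hC : C' ⊆ C) : GenericOver rel δ E R' C' := by
  intro n r x hx hE ⟨k, hk⟩
  exact h n r x (fun k => Set.union_subset_union_left _ hC (hx k)) hE
    ⟨k, fun hk' => hk (Set.union_subset_union_left _ hR hk')⟩

/-- No tuple leaves `R = univ`, so nothing is asserted; this is where the shrinking of `R` to the
common fixed points starts. -/
theorem GenericOver.univ (E C : Set M) : GenericOver rel δ E Set.univ C := by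
  intro n r x _ _ ⟨k, hk⟩
  simp at hk

/-- `(g', A')` is an extension of the partial automorphism `(g, A)`, that is, of the restriction of
`g` to `A`. -/
def Extends (g : G) (A : Finset M) (g' : G) (A' : Finset M) : Prop :=
  A ⊆ A' ∧ ∀ a ∈ A, g' • a = g • a

theorem Extends.refl (g : G) (A : Finset M) : Extends g A g A := ⟨subset_rfl, fun _ _ => rfl⟩

theorem Extends.trans {g₁ g₂ g₃ : G} {A₁ A₂ A₃ : Finset M} (h : Extends g₁ A₁ g₂ A₂)
    (h' : Extends g₂ A₂ g₃ A₃) : Extends g₁ A₁ g₃ A₃ :=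
  ⟨h.1.trans h'.1, fun a ha => (h'.2 a (h.1 ha)).trans (h.2 a ha)⟩

/-- `K` is pointwise fixed by the partial automorphism `(g, A)`. -/
def FixedOn (K : Finset M) (g : G) (A : Finset M) : Prop := ∀ k ∈ K, k ∈ A ∧ g • k = k

theorem FixedOn.extends {K A A' : Finset M} {g g' : G} (h : FixedOn K g A)
    (h' : Extends g A g' A') : FixedOn K g' A' :=
  fun k hk => ⟨h'.1 (h k hk).1, (h'.2 k (h k hk).1).trans (h k hk).2⟩

/-- An extension all of whose fixed points are old. -/
def NoNewFixed (A : Finset M) (g' : G) (A' : Finset M) : Prop :=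
  ∀ a ∈ A', g' • a = a → a ∈ A

theorem NoNewFixed.trans {g₂ g₃ : G} {A₁ A₂ A₃ : Finset M} (h : NoNewFixed A₁ g₂ A₂)
    (h₂ : Extends g₂ A₂ g₃ A₃) (h' : NoNewFixed A₂ g₃ A₃) : NoNewFixed A₁ g₃ A₃ :=
  fun a ha hf => h a (h' a ha hf) (by rw [← h₂.2 a (h' a ha hf), hf])

variable [LinearOrder M]

/-- An order preserving action on a relational structure that is homogeneous and in which types over
finite sets have extensions that are generic and have a prescribed cut. -/
structure GenericOrderedAction (G : Type*) {M : Type*} [LinearOrder M] [Group G] [MulAction G M]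
    {I : ℕ → Type*} (rel : ∀ n, I n → (Fin n → M) → Prop)
    (δ : ∀ n, I n → Set (Fin n) → Prop) : Prop where
  lt_smul : ∀ (g : G) {a b : M}, g • a < g • b ↔ a < b
  rel_smul : ∀ (g : G) (n : ℕ) (r : I n) (x : Fin n → M), rel n r (fun k => g • x k) ↔ rel n r x
  hom : ∀ (X : Finset M) (κ : M → M), (∀ a ∈ X, ∀ b ∈ X, a < b → κ a < κ b) →
    (∀ (n : ℕ) (r : I n) (x : Fin n → M), (∀ k, x k ∈ X) →
      (rel n r (fun k => κ (x k)) ↔ rel n r x)) →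
    ∃ g : G, ∀ a ∈ X, g • a = κ a
  -- As `r` fixes `A`, the point `r • b` realizes the type of `b` over `A`; its cut in `C` is free
  -- apart from agreeing with that of `b` on `A`.
  ext : ∀ (A C : Finset M) (b : M) (D : M → Prop), A ⊆ C → b ∉ A →
    (∀ c ∈ C, ∀ c' ∈ C, c ≤ c' → D c' → D c) → (∀ a ∈ A, D a ↔ a < b) →
    ∃ r : G, (∀ a ∈ A, r • a = a) ∧ r • b ∉ C ∧ (∀ c ∈ C, c < r • b ↔ D c) ∧
      GenericOver rel δ {r • b} A C
  -- Needed when generic points are added one at a time: the prescription for the newest point must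
  -- agree with the one for all of them together.
  union : ∀ (n : ℕ) (r : I n) (T T' : Set (Fin n)), T.Nonempty → T'.Nonempty → Disjoint T T' →
    (∃ k, k ∉ T ∪ T') → (δ n r T ↔ δ n r (T ∪ T'))

/-- A set cut out by the points of `K`. -/
structure IsCell (K : Finset M) (J : Set M) : Prop where
  lt_right : ∀ {a b}, b ∈ J → a ∉ J → b < a → ∃ k ∈ K, b < k ∧ k ≤ a
  lt_left : ∀ {a b}, b ∈ J → a ∉ J → a < b → ∃ k ∈ K, a ≤ k ∧ k < b
  notMem : ∀ k ∈ K, k ∉ J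
  side : ∀ {a b k}, a ∈ J → b ∈ J → k ∈ K → a < k → b < k

/-- For the empty cell separation is vacuous and every new image is as high as possible, which is
what the genericity stage uses. -/
theorem IsCell.empty (K : Finset M) : IsCell K ∅ :=
  ⟨fun h => h.elim, fun h => h.elim, fun _ _ h => h, fun h => h.elim⟩

/-- The cell of `K` that contains `x`. -/
def cell (K : Finset M) (x : M) : Set M := {a | ∀ k ∈ K, (a < k ↔ x < k) ∧ (k < a ↔ k < x)}

theorem mem_cell_self (K : Finset M) (x : M) : x ∈ cell K x := fun _ _ => ⟨Iff.rfl, Iff.rfl⟩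

theorem isCell_cell {K : Finset M} {x : M} (hx : x ∉ K) : IsCell K (cell K x) where
  lt_right {a b} hb ha hab := by
    by_contra! h
    refine ha fun k hk => ?_
    have h1 := hb k hk
    have h2 := h k hk
    have h3 : b ≠ k := by rintro rfl; grind
    constructor <;> grind
  lt_left {a b} hb ha hab := by
    by_contra! h
    refine ha fun k hk => ?_
    have h1 := hb k hk
    have h2 := h k hk
    have h3 : b ≠ k := by rintro rfl; grind
    constructor <;> grind
  notMem k hk h := by
    have := h k hk
    have h3 : x ≠ k := by rintro rfl; exact hx hk
    grind
  side ha hb hk h := ((hb _ hk).1.2 ((ha _ hk).1.1 h))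

/-- `d` lies strictly between `x` and `y`. -/
def Between (d x y : M) : Prop := (x < d ∧ d < y) ∨ (y < d ∧ d < x)

/-- Every point of the cell `J` that `g` moves down is separated from `x` by a fixed point. -/
def UpAt (J : Set M) (g : G) (A : Finset M) (x : M) : Prop :=
  ∀ b ∈ A, b ∈ J → g • b < b → ∃ d ∈ A, g • d = d ∧ Between d x b

/-- Every point of the cell `J` that `g` moves up is separated from `x` by a fixed point. -/
def DownAt (J : Set M) (g : G) (A : Finset M) (x : M) : Prop :=
  ∀ b ∈ A, b ∈ J → b < g • b → ∃ d ∈ A, g • d = d ∧ Between d x b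

/-- Within `J`, points that `g` moves up and points that `g` moves down are separated by fixed
points. -/
def Separated (J : Set M) (g : G) (A : Finset M) : Prop :=
  ∀ a ∈ A, a ∈ J → a < g • a → UpAt J g A a

/-- `e` lies to the right of all points of `S` in its cell. -/
def Escapes (K S : Finset M) (e : M) : Prop := ∀ c ∈ S, e ≤ c → ∃ k ∈ K, e < k ∧ k ≤ c

theorem Escapes.mono {K S S' : Finset M} {e : M} (h : Escapes K S e) (hS : S' ⊆ S) :
    Escapes K S' e := fun c hc => h c (hS hc)

theorem Escapes.notMem {K S : Finset M} {e : M} (h : Escapes K S e) : e ∉ S := fun he => by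
  obtain ⟨k, -, h1, h2⟩ := h e he le_rfl
  exact (h1.trans_le h2).false

/-! ### One-point extensions and extension by the identity -/

namespace GenericOrderedAction

variable (hG : GenericOrderedAction G rel δ)
include hG

theorem le_smul (g : G) {a b : M} : g • a ≤ g • b ↔ a ≤ b := by
  rw [← not_lt, ← not_lt, hG.lt_smul]

theorem lt_smul_iff_of_fixed {g : G} {d a : M} (hd : g • d = d) : d < g • a ↔ d < a := by
  conv_lhs => rw [← hd]
  exact hG.lt_smul g

theorem smul_lt_iff_of_fixed {g : G} {d a : M} (hd : g • d = d) : g • a < d ↔ a < d := by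
  conv_lhs => rw [← hd]
  exact hG.lt_smul g

theorem le_smul_iff_of_fixed {g : G} {d a : M} (hd : g • d = d) : d ≤ g • a ↔ d ≤ a := by
  conv_lhs => rw [← hd]
  exact hG.le_smul g

theorem between_smul_iff {g : G} {d a b : M} (hd : g • d = d) :
    Between d b (g • a) ↔ Between d b a := by
  simp only [Between, hG.lt_smul_iff_of_fixed hd, hG.smul_lt_iff_of_fixed hd]

/-- Entering or leaving `J` would mean crossing a point of `K`, and an order-preserving map does not
carry points across its fixed points. -/
theorem smul_mem_cell {K A : Finset M} {J : Set M} (hJ : IsCell K J) {g : G}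
    (hK : FixedOn K g A) {a : M} : g • a ∈ J ↔ a ∈ J := by
  constructor
  · intro h
    by_contra ha
    rcases lt_trichotomy (g • a) a with h1 | h1 | h1
    · obtain ⟨k, hk, h2, h3⟩ := hJ.lt_right h ha h1
      rw [hG.smul_lt_iff_of_fixed (hK k hk).2] at h2
      exact (h2.trans_le h3).false
    · exact ha (h1 ▸ h)
    · obtain ⟨k, hk, h2, h3⟩ := hJ.lt_left h ha h1
      rw [hG.lt_smul_iff_of_fixed (hK k hk).2] at h3
      exact (h3.trans_le h2).false
  · intro h
    by_contra ha
    rcases lt_trichotomy (g • a) a with h1 | h1 | h1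
    · obtain ⟨k, hk, h2, h3⟩ := hJ.lt_left h ha h1
      rw [← hG.lt_smul_iff_of_fixed (hK k hk).2] at h3
      exact (h3.trans_le h2).false
    · exact ha (by rwa [h1])
    · obtain ⟨k, hk, h2, h3⟩ := hJ.lt_right h ha h1
      rw [← hG.smul_lt_iff_of_fixed (hK k hk).2] at h2
      exact (h2.trans_le h3).false

/-- A partial automorphism can be extended to one more point, with generic image in a prescribed
cut. -/
theorem exists_extension (g : G) {A C : Finset M} {b : M} (D : M → Prop) (hb : b ∉ A)
    (hAC : ∀ a ∈ A, g • a ∈ C) (hD : ∀ c c', c ≤ c' → D c' → D c)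
    (hA : ∀ a ∈ A, D (g • a) ↔ a < b) :
    ∃ g' : G, (∀ a ∈ A, g' • a = g • a) ∧ g' • b ∉ C ∧ (∀ c ∈ C, c < g' • b ↔ D c) ∧
      GenericOver rel δ {g' • b} ((g • ·) '' (A : Set M)) C := by
  obtain ⟨r, h1, h2, h3, h4⟩ := hG.ext (A.image (g • ·)) C (g • b) D
    (by intro c hc; obtain ⟨a, ha, rfl⟩ := Finset.mem_image.1 hc; exact hAC a ha)
    (by
      intro hc
      obtain ⟨a, ha, h⟩ := Finset.mem_image.1 hc
      exact hb ((MulAction.injective g h) ▸ ha))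
    (fun c _ c' _ => hD c c')
    (by
      intro c hc
      obtain ⟨a, ha, rfl⟩ := Finset.mem_image.1 hc
      rw [hA a ha, hG.lt_smul])
  refine ⟨r * g, fun a ha => ?_, ?_, ?_, ?_⟩
  · rw [mul_smul, h1 _ (Finset.mem_image_of_mem _ ha)]
  · rwa [mul_smul]
  · simpa only [mul_smul] using h3
  · rw [mul_smul]
    simpa using h4

/-- The extension to one more point whose image is as high as possible. -/
theorem exists_extension_high (g : G) {A C : Finset M} {b : M} (hb : b ∉ A)
    (hAC : ∀ a ∈ A, g • a ∈ C) :
    ∃ g' : G, (∀ a ∈ A, g' • a = g • a) ∧ g' • b ∉ C ∧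
      (∀ c ∈ C, c < g' • b ↔ ∀ a ∈ A, b < a → c < g • a) ∧
      GenericOver rel δ {g' • b} ((g • ·) '' (A : Set M)) C := by
  refine hG.exists_extension g (fun c => ∀ a ∈ A, b < a → c < g • a) hb hAC
    (fun c c' h h' a ha hba => h.trans_lt (h' a ha hba)) (fun a ha => ⟨fun h => ?_, fun h => ?_⟩)
  · by_contra! h'
    have : b < a := lt_of_le_of_ne h' (by rintro rfl; exact hb ha)
    exact (h a ha this).false
  · intro a' _ hba
    exact (hG.lt_smul g).2 (h.trans hba)

/-- The extension to one more point whose image is as low as possible. -/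
theorem exists_extension_low (g : G) {A C : Finset M} {b : M} (hb : b ∉ A)
    (hAC : ∀ a ∈ A, g • a ∈ C) :
    ∃ g' : G, (∀ a ∈ A, g' • a = g • a) ∧ g' • b ∉ C ∧
      (∀ c ∈ C, c < g' • b ↔ ∃ a ∈ A, a < b ∧ c ≤ g • a) ∧
      GenericOver rel δ {g' • b} ((g • ·) '' (A : Set M)) C := by
  refine hG.exists_extension g (fun c => ∃ a ∈ A, a < b ∧ c ≤ g • a) hb hAC
    (fun c c' h ⟨a, ha, h1, h2⟩ => ⟨a, ha, h1, h.trans h2⟩)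
    (fun a ha => ⟨fun ⟨a', _, h1, h2⟩ => ?_, fun h => ⟨a, ha, h, le_rfl⟩⟩)
  exact ((hG.le_smul g).1 h2).trans_lt h1

/-- A partial automorphism can be extended by the identity on a set of points that are generic
relative to fixed points and whose cuts are invariant. -/
theorem exists_extension_id (g : G) {A E : Finset M} {R : Set M}
    (hR : ∀ a ∈ A, a ∈ R ∨ g • a ∈ R → g • a = a)
    (hE : ∀ e ∈ E, e ∉ A ∧ ∀ a ∈ A, g • a ≠ e)
    (hcut : ∀ a ∈ A, ∀ e ∈ E, a < e ↔ g • a < e)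
    (hgen : GenericOver rel δ (E : Set M) R (A ∪ (g • ·) '' (A : Set M))) :
    ∃ g' : G, (∀ a ∈ A, g' • a = g • a) ∧ ∀ e ∈ E, g' • e = e := by
  classical
  set κ : M → M := fun a => if a ∈ A then g • a else a with hκ
  have hκA : ∀ a ∈ A, κ a = g • a := fun a ha => by simp [hκ, ha]
  have hκE : ∀ e ∈ E, κ e = e := fun e he => by simp [hκ, (hE e he).1]
  have hκE' : ∀ a ∈ A ∪ E, (κ a ∈ E ↔ a ∈ E) := by
    intro a ha
    rcases Finset.mem_union.1 ha with ha | ha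
    · rw [hκA a ha]
      exact ⟨fun h => ((hE _ h).2 a ha rfl).elim, fun h => ((hE _ h).1 ha).elim⟩
    · rw [hκE a ha]
  obtain ⟨g', hg'⟩ := hG.hom (A ∪ E) κ (by
      intro a ha b hb hab
      rcases Finset.mem_union.1 ha with ha | ha <;> rcases Finset.mem_union.1 hb with hb | hb
      · rw [hκA a ha, hκA b hb]; exact (hG.lt_smul g).2 hab
      · rw [hκA a ha, hκE b hb]; exact (hcut a ha b hb).1 hab
      · rw [hκE a ha, hκA b hb]
        by_contra! h
        have h1 : g • b < a := lt_of_le_of_ne h ((hE a ha).2 b hb)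
        exact (((hcut b hb a ha).2 h1).trans hab).false
      · rwa [hκE a ha, hκE b hb]) (by
      -- A tuple that meets `E` and leaves `R ∪ E` has the same `E`-coordinates as its image, so `δ`
      -- decides both alike; a tuple inside `R ∪ E` is not moved; off `E` the map `κ` is `g`.
      intro n r x hx
      by_cases h1 : ∃ k, x k ∈ E
      · by_cases h2 : ∃ k, x k ∉ R ∪ (E : Set M)
        · rw [hgen n r x _ h1 h2, hgen n r (fun k => κ (x k))]
          · have : {k | κ (x k) ∈ (E : Set M)} = {k | x k ∈ (E : Set M)} := by
              ext k
              exact hκE' _ (hx k)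
            rw [this]
          · intro k
            rcases Finset.mem_union.1 (hx k) with h | h
            · rw [hκA _ h]; exact Or.inl (Or.inr ⟨_, h, rfl⟩)
            · rw [hκE _ h]; exact Or.inr h
          · obtain ⟨k, hk⟩ := h1
            exact ⟨k, (hκE' _ (hx k)).2 hk⟩
          · obtain ⟨k, hk⟩ := h2
            refine ⟨k, fun h => hk ?_⟩
            rcases Finset.mem_union.1 (hx k) with h' | h'
            · rw [hκA _ h'] at h
              rcases h with h | h
              · rw [hR _ h' (Or.inr h)] at h
                exact Or.inl h
              · exact ((hE _ h).2 _ h' rfl).elim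
            · exact Or.inr h'
          · intro k
            rcases Finset.mem_union.1 (hx k) with h | h
            · exact Or.inl (Or.inl h)
            · exact Or.inr h
        · push Not at h2
          have : (fun k => κ (x k)) = x := by
            funext k
            rcases Finset.mem_union.1 (hx k) with h | h
            · rw [hκA _ h]
              rcases h2 k with h3 | h3
              · exact hR _ h (Or.inl h3)
              · exact ((hE _ h3).1 h).elim
            · exact hκE _ h
          rw [this]
      · have : (fun k => κ (x k)) = fun k => g • x k := by
          funext k
          rcases Finset.mem_union.1 (hx k) with h | h
          · exact hκA _ h
          · exact (h1 ⟨k, h⟩).elim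
        rw [this, hG.rel_smul])
  refine ⟨g', fun a ha => ?_, fun e he => ?_⟩
  · rw [hg' a (Finset.mem_union_left _ ha), hκA a ha]
  · rw [hg' e (Finset.mem_union_right _ he), hκE e he]

end GenericOrderedAction

theorem Between.symm {d x y : M} (h : Between d x y) : Between d y x := Or.symm h

/-- Some `c` moved down is not separated from `b`. A fixed point separating `c` from a point moved
up is then not between `b` and `c`, so it separates `b` from that point. -/
theorem Separated.downAt {J : Set M} {g : G} {A : Finset M} {b : M} (h : Separated J g A)
    (hb : b ∉ A) (hup : ¬ UpAt J g A b) : DownAt J g A b := by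
  intro a ha haJ hag
  simp only [UpAt, not_forall] at hup
  obtain ⟨c, hc, hcJ, hcg, hno⟩ := hup
  obtain ⟨d, hd, hdg, hdb⟩ := h a ha haJ hag c hc hcJ hcg
  refine ⟨d, hd, hdg, ?_⟩
  have h1 : ¬ Between d b c := fun h' => hno ⟨d, hd, hdg, h'⟩
  have h2 : d ≠ b := by rintro rfl; exact hb hd
  simp only [Between] at *
  grind

/-! ### Controlled extensions, climbing and blocks -/

namespace GenericOrderedAction

variable (hG : GenericOrderedAction G rel δ)
include hG

/-- One step of the extension process: off the cell `J`, or where `g` moves up, the new image is as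
high as possible. -/
theorem exists_step {K A C : Finset M} {J : Set M} {g : G} {b : M} (hJ : IsCell K J)
    (hK : FixedOn K g A) (hs : Separated J g A) (hb : b ∉ A) (hAC : ∀ a ∈ A, g • a ∈ C)
    (hbC : b ∈ C) :
    ∃ g' : G, (∀ a ∈ A, g' • a = g • a) ∧ g' • b ∉ C ∧ Separated J g' (insert b A) ∧
      NoNewFixed A g' (insert b A) ∧
      GenericOver rel δ {g' • b} ((g • ·) '' (A : Set M)) C ∧
      ((b ∈ J → UpAt J g A b) → (∀ c ∈ C, c < g' • b ↔ ∀ a ∈ A, b < a → c < g • a) ∧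
        (b ∈ J → b < g' • b)) := by
  have hnew : ∀ g' : G, g' • b ∉ C → NoNewFixed A g' (insert b A) := by
    intro g' h a ha hf
    rcases Finset.mem_insert.1 ha with rfl | ha
    · exact (h (by rwa [hf])).elim
    · exact ha
  -- In `J`, the highest image moves `b` up if no downward point is in the way; otherwise `downAt`
  -- applies and the lowest image moves `b` down. Either way separation persists.
  by_cases hup : b ∈ J → UpAt J g A b
  · obtain ⟨g', h1, h2, h3, h4⟩ := hG.exists_extension_high g hb hAC
    have hlt : b ∈ J → b < g' • b := by
      intro hbJ
      rw [h3 b hbC]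
      intro a ha hba
      by_contra! hle
      by_cases haJ : a ∈ J
      · obtain ⟨d, hd, hdg, hdb⟩ := hup hbJ a ha haJ (hle.trans_lt hba)
        rcases hdb with ⟨h5, h6⟩ | ⟨h5, h6⟩
        · rw [← hG.lt_smul_iff_of_fixed hdg] at h6
          exact ((h6.trans_le hle).trans h5).false
        · exact ((h5.trans h6).trans hba).false
      · obtain ⟨k, hk, h5, h6⟩ := hJ.lt_right hbJ haJ hba
        rw [← hG.le_smul_iff_of_fixed (hK k hk).2] at h6
        exact ((h5.trans_le h6).trans_le hle).false
    refine ⟨g', h1, h2, ?_, hnew g' h2, h4, fun _ => ⟨h3, hlt⟩⟩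
    intro a ha haJ hag c hc hcJ hcg
    rcases Finset.mem_insert.1 hc with rfl | hc
    · exact (hcg.trans (hlt hcJ)).false.elim
    · rw [h1 c hc] at hcg
      have : UpAt J g A a := by
        rcases Finset.mem_insert.1 ha with rfl | ha
        · exact hup haJ
        · rw [h1 a ha] at hag
          exact hs a ha haJ hag
      obtain ⟨d, hd, hdg, hdb⟩ := this c hc hcJ hcg
      exact ⟨d, Finset.mem_insert_of_mem hd, by rw [h1 d hd, hdg], hdb⟩
  · obtain ⟨g', h1, h2, h3, h4⟩ := hG.exists_extension_low g hb hAC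
    have hbJ : b ∈ J := by by_contra h; exact hup fun h' => (h h').elim
    have hdown : DownAt J g A b := hs.downAt hb fun h => hup fun _ => h
    have hlt : g' • b < b := by
      have h5 : ¬ b < g' • b := by
        rw [h3 b hbC]
        rintro ⟨a, ha, hab, hle⟩
        by_cases haJ : a ∈ J
        · obtain ⟨d, hd, hdg, hdb⟩ := hdown a ha haJ (hab.trans_le hle)
          rcases hdb with ⟨h5, h6⟩ | ⟨h5, h6⟩
          · exact ((h5.trans h6).trans hab).false
          · rw [← hG.smul_lt_iff_of_fixed hdg] at h5
            exact ((h5.trans h6).trans_le hle).false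
        · obtain ⟨k, hk, h5, h6⟩ := hJ.lt_left hbJ haJ hab
          have h7 : g • a ≤ k := by
            rw [← not_lt, hG.lt_smul_iff_of_fixed (hK k hk).2, not_lt]; exact h5
          exact ((h7.trans_lt h6).trans_le hle).false
      exact lt_of_le_of_ne (not_lt.1 h5) fun h => h2 (by rwa [h])
    refine ⟨g', h1, h2, ?_, hnew g' h2, h4, fun h => (hup h).elim⟩
    intro a ha haJ hag c hc hcJ hcg
    rcases Finset.mem_insert.1 ha with rfl | haA
    · exact (hag.trans hlt).false.elim
    · rw [h1 a haA] at hag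
      rcases Finset.mem_insert.1 hc with rfl | hc
      · obtain ⟨d, hd, hdg, hdb⟩ := hdown a haA haJ hag
        exact ⟨d, Finset.mem_insert_of_mem hd, by rw [h1 d hd, hdg], hdb.symm⟩
      · rw [h1 c hc] at hcg
        obtain ⟨d, hd, hdg, hdb⟩ := hs a haA haJ hag c hc hcJ hcg
        exact ⟨d, Finset.mem_insert_of_mem hd, by rw [h1 d hd, hdg], hdb⟩

/-- Extending a partial automorphism to a finite set `P`. -/
theorem exists_extension_finset {K A : Finset M} {J : Set M} {g : G} (hJ : IsCell K J)
    (hK : FixedOn K g A) (hs : Separated J g A) (P W : Finset M) :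
    ∃ g' : G, Extends g A g' (A ∪ P) ∧ Separated J g' (A ∪ P) ∧ NoNewFixed A g' (A ∪ P) ∧
      (∀ e ∈ P, e ∉ J → Escapes K A e → Escapes K W (g' • e)) ∧
      ((∀ e ∈ P, e ∉ A) →
        GenericOver rel δ ((g' • ·) '' (P : Set M)) ((g • ·) '' (A : Set M)) W) := by
  -- Points are added in increasing order, so the highest image of a new point is bounded only by
  -- images of points of `A`, and escaping from `A` puts a point of `K` below those.
  induction P using Finset.induction_on_max with
  | empty => exact ⟨g, by simpa using Extends.refl g A, by simpa using hs,
      fun a ha _ => by simpa using ha, by simp, fun _ n r x _ h => by simp at h⟩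
  | insert e P hmax ih =>
    obtain ⟨g₁, h1, h2, h3, h4, h5⟩ := ih
    by_cases he : e ∈ A
    · have : A ∪ insert e P = A ∪ P := by
        ext c; simp only [Finset.mem_union, Finset.mem_insert]; grind
      rw [this]
      refine ⟨g₁, h1, h2, h3, ?_, fun h => (h e (Finset.mem_insert_self e P) he).elim⟩
      intro c hc hcJ hesc
      rcases Finset.mem_insert.1 hc with rfl | hc
      · exact (hesc.notMem he).elim
      · exact h4 c hc hcJ hesc
    · have heP : e ∉ P := fun h => (hmax e h).false
      have he' : e ∉ A ∪ P := by simp [he, heP]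
      set C := insert e (W ∪ (A ∪ P).image (g₁ • ·)) with hC
      have hCW : W ⊆ C := fun c hc => by simp [hC, hc]
      have hCA : ∀ a ∈ A ∪ P, g₁ • a ∈ C := fun a ha =>
        Finset.mem_insert_of_mem (Finset.mem_union_right _ (Finset.mem_image_of_mem _ ha))
      obtain ⟨g', k1, k2, k3, k4, k5, k6⟩ := hG.exists_step hJ (hK.extends h1) h2 he' hCA
        (Finset.mem_insert_self _ _)
      have hins : A ∪ insert e P = insert e (A ∪ P) := Finset.union_insert e A P
      have hext : Extends g₁ (A ∪ P) g' (insert e (A ∪ P)) := ⟨Finset.subset_insert _ _, k1⟩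
      rw [hins]
      refine ⟨g', h1.trans hext, k3, h3.trans hext k4, ?_, ?_⟩
      · intro c hc hcJ hesc
        rcases Finset.mem_insert.1 hc with rfl | hc
        · intro w hw hle
          have hlt : ¬ w < g' • c := not_lt.2 hle
          rw [(k6 fun h => (hcJ h).elim).1 w (hCW hw)] at hlt
          push Not at hlt
          obtain ⟨a, ha, hca, haw⟩ := hlt
          rcases Finset.mem_union.1 ha with ha | ha
          · obtain ⟨k, hk, q1, q2⟩ := hesc a ha hca.le
            refine ⟨k, hk, ?_, ?_⟩
            · rwa [hG.smul_lt_iff_of_fixed ((hK.extends (h1.trans hext)) k hk).2]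
            · refine le_trans ?_ haw
              rwa [hG.le_smul_iff_of_fixed (hK.extends h1 k hk).2]
          · exact ((hmax a ha).trans hca).false.elim
        · rw [k1 c (Finset.mem_union_right _ hc)]
          exact h4 c hc hcJ hesc
      · intro hdis
        have h5' := h5 fun a ha => hdis a (Finset.mem_insert_of_mem ha)
        have himg : ((g' • ·) '' ((insert e P : Finset M) : Set M)) =
            insert (g' • e) ((g₁ • ·) '' (P : Set M)) := by
          rw [Finset.coe_insert, Set.image_insert_eq]
          congr 1
          exact Set.image_congr fun a ha => k1 a (Finset.mem_union_right _ ha)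
        rw [himg]
        have hCP : ∀ c ∈ (g₁ • ·) '' (P : Set M), c ∈ C := by
          rintro _ ⟨a, ha, rfl⟩
          exact hCA a (Finset.mem_union_right _ ha)
        intro n r x hx hE hR
        by_cases hxe : ∃ k, x k = g' • e
        · have hset : {k | x k ∈ insert (g' • e) ((g₁ • ·) '' (P : Set M))} =
              {k | x k ∈ ({g' • e} : Set M)} ∪ {k | x k ∈ (g₁ • ·) '' (P : Set M)} := by
            ext k; simp
          obtain ⟨k₀, hk₀⟩ := hR
          rw [k5 n r x, hset]
          · by_cases hne : {k | x k ∈ (g₁ • ·) '' (P : Set M)}.Nonempty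
            -- Genericity of the newest image speaks only of its own coordinates; `union` adds those
            -- of the earlier images.
            · refine hG.union n r _ _ hxe hne ?_ ⟨k₀, ?_⟩
              · rw [Set.disjoint_left]
                intro k hk hk'
                simp only [Set.mem_ofPred_eq, Set.mem_singleton_iff] at hk
                exact k2 (hk ▸ hCP _ hk')
              · rw [← hset]
                exact fun h => hk₀ (Or.inr h)
            · rw [Set.not_nonempty_iff_eq_empty.1 hne, Set.union_empty]
          · intro k
            rcases hx k with h | h | h
            · exact Or.inl (hCW h)
            · exact Or.inr h
            · exact Or.inl (hCP _ h)
          · exact hxe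
          · refine ⟨k₀, fun h => hk₀ ?_⟩
            rcases h with ⟨a, ha, h⟩ | h
            · rcases Finset.mem_union.1 ha with ha | ha
              · exact Or.inl ⟨a, ha, by rw [← h]; exact (h1.2 a ha).symm⟩
              · exact Or.inr (Or.inr ⟨a, ha, h⟩)
            · exact Or.inr (Or.inl h)
        · have hset : {k | x k ∈ insert (g' • e) ((g₁ • ·) '' (P : Set M))} =
              {k | x k ∈ (g₁ • ·) '' (P : Set M)} := by
            ext k
            simp only [Set.mem_ofPred_eq, Set.mem_insert_iff]
            exact ⟨fun h => h.resolve_left fun h' => hxe ⟨k, h'⟩, Or.inr⟩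
          rw [hset]
          refine h5' n r x (fun k => ?_) ?_ ?_
          · rcases hx k with h | h | h
            · exact Or.inl h
            · exact (hxe ⟨k, h⟩).elim
            · exact Or.inr h
          · obtain ⟨k, hk⟩ := hE
            exact ⟨k, hk.resolve_left fun h' => hxe ⟨k, h'⟩⟩
          · obtain ⟨k, hk⟩ := hR
            exact ⟨k, fun h => hk (h.imp_right Or.inr)⟩

end GenericOrderedAction

omit [LinearOrder M] in
theorem zpow_smul_eq_self {g : G} {d : M} (h : g • d = d) (n : ℤ) : g ^ n • d = d :=
  MulAction.mem_stabilizer_iff.1 (Subgroup.zpow_mem _ (MulAction.mem_stabilizer_iff.2 h) n)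

omit [LinearOrder M] in
theorem pow_smul_eq_of_agree {g h : G} {A : Finset M} (hgh : ∀ a ∈ A, h • a = g • a) {b : M} :
    ∀ n : ℕ, (∀ i < n, g ^ i • b ∈ A) → h ^ n • b = g ^ n • b
  | 0, _ => by simp
  | n + 1, hb => by
    rw [pow_succ', pow_succ', mul_smul, mul_smul,
      pow_smul_eq_of_agree hgh n fun i hi => hb i (by omega), hgh _ (hb n (by omega))]

/-- The partial automorphism `(g, A)` determines the values of `g ^ n` on `P`. -/
def DeterminesPow (g : G) (A : Finset M) (n : ℤ) (P : Finset M) : Prop :=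
  ∀ b ∈ P, ∀ h : G, (∀ a ∈ A, h • a = g • a) → h ^ n • b = g ^ n • b

theorem FixedOn.inv {K A : Finset M} {g : G} (h : FixedOn K g A) :
    FixedOn K g⁻¹ (A.image (g • ·)) := fun k hk =>
  ⟨Finset.mem_image.2 ⟨k, h k hk⟩, by rw [inv_smul_eq_iff, (h k hk).2]⟩

theorem Extends.of_inv {A B : Finset M} {g h : G} (hh : Extends g⁻¹ (A.image (g • ·)) h B) :
    Extends g A h⁻¹ (B.image (h • ·)) := by
  have key : ∀ a ∈ A, h • g • a = a := fun a ha => by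
    rw [hh.2 _ (Finset.mem_image_of_mem _ ha), inv_smul_smul]
  refine ⟨fun a ha => Finset.mem_image.2 ⟨g • a, hh.1 (Finset.mem_image_of_mem _ ha), key a ha⟩,
    fun a ha => ?_⟩
  rw [inv_smul_eq_iff, key a ha]

theorem NoNewFixed.of_inv {A B : Finset M} {g h : G} (hh : NoNewFixed (A.image (g • ·)) h B)
    (he : Extends g⁻¹ (A.image (g • ·)) h B) : NoNewFixed A h⁻¹ (B.image (h • ·)) := by
  intro a ha hf
  obtain ⟨b, hb, rfl⟩ := Finset.mem_image.1 ha
  rw [inv_smul_smul] at hf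
  have h1 := hh b hb hf.symm
  obtain ⟨c, hc, hcb⟩ := Finset.mem_image.1 h1
  have h2 := he.2 b h1
  rw [← hcb, inv_smul_smul] at h2
  change g • c = b at hcb
  rw [← hcb, h2]
  exact hc

theorem DeterminesPow.of_inv {B P : Finset M} {h : G} {n : ℤ} (hd : DeterminesPow h B n P) :
    DeterminesPow h⁻¹ (B.image (h • ·)) (-n) P := by
  intro b hb f hf
  have h1 := hd b hb f⁻¹ fun c hc => by
    rw [inv_smul_eq_iff, hf _ (Finset.mem_image_of_mem _ hc), inv_smul_smul]
  rw [zpow_neg, ← inv_zpow, h1, inv_zpow', neg_neg]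

namespace GenericOrderedAction

variable (hG : GenericOrderedAction G rel δ)
include hG

/-- Inversion exchanges up and down, and a fixed point separates `g • a` from `g • b` exactly when
it separates `a` from `b`. -/
theorem separated_inv {K A : Finset M} {J : Set M} {g : G} (hJ : IsCell K J) (hK : FixedOn K g A)
    (hs : Separated J g A) : Separated J g⁻¹ (A.image (g • ·)) := by
  intro a' ha' ha'J hag b' hb' hb'J hbg
  obtain ⟨a, ha, rfl⟩ := Finset.mem_image.1 ha'
  obtain ⟨b, hb, rfl⟩ := Finset.mem_image.1 hb'
  rw [inv_smul_smul] at hag hbg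
  obtain ⟨d, hd, hdg, hdb⟩ := hs b hb ((hG.smul_mem_cell hJ hK).1 hb'J) hbg a ha
    ((hG.smul_mem_cell hJ hK).1 ha'J) hag
  refine ⟨d, Finset.mem_image.2 ⟨d, hd, hdg⟩, by rw [inv_smul_eq_iff, hdg], ?_⟩
  exact (hG.between_smul_iff hdg).2 ((hG.between_smul_iff hdg).2 hdb).symm

theorem upAt_inv {K A : Finset M} {J : Set M} {g : G} {x : M} (hJ : IsCell K J)
    (hK : FixedOn K g A) (hs : DownAt J g A x) : UpAt J g⁻¹ (A.image (g • ·)) x := by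
  intro b' hb' hb'J hbg
  obtain ⟨b, hb, rfl⟩ := Finset.mem_image.1 hb'
  rw [inv_smul_smul] at hbg
  obtain ⟨d, hd, hdg, hdb⟩ := hs b hb ((hG.smul_mem_cell hJ hK).1 hb'J) hbg
  exact ⟨d, Finset.mem_image.2 ⟨d, hd, hdg⟩, by rw [inv_smul_eq_iff, hdg],
    (hG.between_smul_iff hdg).2 hdb⟩

/-- `x` and `g' • x` lie on the same side of every fixed point, and the only new domain point moves
up; so the climb can go on. -/
theorem upAt_smul {A : Finset M} {J : Set M} {g g' : G} {x : M} (hA : ∀ a ∈ A, g' • a = g • a)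
    (hup : UpAt J g A x) (hx : x < g' • x) : UpAt J g' (insert x A) (g' • x) := by
  intro b hb hbJ hbg
  rcases Finset.mem_insert.1 hb with rfl | hb'
  · exact (hx.trans hbg).false.elim
  · rw [hA b hb'] at hbg
    obtain ⟨d, hd, hdg, hdb⟩ := hup b hb' hbJ hbg
    have hdg' : g' • d = d := by rw [hA d hd, hdg]
    exact ⟨d, Finset.mem_insert_of_mem hd, hdg', ((hG.between_smul_iff hdg').2 hdb.symm).symm⟩

/-- One step of the climb of `x`: the new position passes one of the points of `W` that are still
to be passed, if there are any. -/
theorem exists_climb_step {K A W : Finset M} {J : Set M} {g : G} {x : M} (hJ : IsCell K J)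
    (hK : FixedOn K g A) (hs : Separated J g A) (hx : x ∈ J) (hup : UpAt J g A x)
    (hxf : x ∈ A → g • x ≠ x) (hW : ∀ a ∈ A, (x < a → a ∈ W) ∧ (x < g • a → g • a ∈ W)) :
    ∃ g' : G, Extends g A g' (insert x A) ∧ Separated J g' (insert x A) ∧
      NoNewFixed A g' (insert x A) ∧ x < g' • x ∧
      ∀ c ∈ W, x < c → c ∈ J → (∀ d ∈ A, g • d = d → x < d → c < d) →
        ∃ c ∈ W, x < c ∧ c ∈ J ∧ (∀ d ∈ A, g • d = d → x < d → c < d) ∧ c ≤ g' • x := by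
  by_cases hxA : x ∈ A
  · have hlt : x < g • x := by
      rcases lt_trichotomy x (g • x) with h | h | h
      · exact h
      · exact (hxf hxA h.symm).elim
      · obtain ⟨d, _, _, h1⟩ := hup x hxA hx h
        rcases h1 with ⟨h1, h2⟩ | ⟨h1, h2⟩ <;> exact (h1.trans h2).false.elim
    rw [Finset.insert_eq_of_mem hxA]
    refine ⟨g, Extends.refl g A, hs, fun a ha _ => ha, hlt, fun _ _ _ _ _ => ?_⟩
    refine ⟨g • x, (hW x hxA).2 hlt, hlt, (hG.smul_mem_cell hJ hK).2 hx, ?_, le_rfl⟩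
    intro d _ hdg hxd
    rwa [hG.smul_lt_iff_of_fixed hdg]
  · obtain ⟨g', k1, k2, k3, k4, -, k6⟩ := hG.exists_step (C := insert x (W ∪ A.image (g • ·)))
      hJ hK hs hxA
      (fun a ha => Finset.mem_insert_of_mem
        (Finset.mem_union_right _ (Finset.mem_image_of_mem _ ha)))
      (Finset.mem_insert_self _ _)
    obtain ⟨k5, k6⟩ := k6 fun _ => hup
    have hWC : ∀ c ∈ W, c ∈ insert x (W ∪ A.image (g • ·)) := fun c hc => by simp [hc]
    refine ⟨g', ⟨Finset.subset_insert _ _, k1⟩, k3, k4, k6 hx, fun c hc hxc hcJ hcd => ?_⟩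
    by_cases hcx : c < g' • x
    · exact ⟨c, hc, hxc, hcJ, hcd, hcx.le⟩
    · rw [k5 c (hWC c hc)] at hcx
      push Not at hcx
      obtain ⟨a', ha', hxa', hac'⟩ := hcx
      -- If `c` is not passed, the image is blocked by some `g • a' ≤ c`. The least domain point `a`
      -- above `x` then lies in `J` before the next fixed point and moves up, so the highest image
      -- of `x` passes `a` instead.
      obtain ⟨a, ha, hmin⟩ := (A.filter (x < ·)).exists_minimal ⟨a', by simp [ha', hxa']⟩
      · simp only [Finset.mem_filter, and_imp] at ha hmin
        obtain ⟨ha, hxa⟩ := ha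
        have hmin' : ∀ b ∈ A, x < b → a ≤ b := fun b hb hxb => by
          by_contra! h
          exact (h.trans_le (hmin hb hxb h.le)).false
        have hac : g • a ≤ c := ((hG.le_smul g).2 (hmin' a' ha' hxa')).trans hac'
        have haJ : a ∈ J := by
          by_contra haJ
          obtain ⟨k, hk, h1, h2⟩ := hJ.lt_right hx haJ hxa
          rw [← hG.le_smul_iff_of_fixed (hK k hk).2] at h2
          exact ((hJ.side hx hcJ hk h1).trans_le (h2.trans hac)).false
        have had : ∀ d ∈ A, g • d = d → x < d → a < d := fun d hd hdg hxd => by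
          rw [← hG.smul_lt_iff_of_fixed hdg]
          exact hac.trans_lt (hcd d hd hdg hxd)
        have hag : a < g • a := by
          rcases lt_trichotomy a (g • a) with h | h | h
          · exact h
          · exact (had a ha h.symm hxa).false.elim
          · obtain ⟨d, hd, hdg, h1⟩ := hup a ha haJ h
            rcases h1 with ⟨h1, h2⟩ | ⟨h1, h2⟩
            · exact (h2.trans_le (hmin' d hd h1)).false.elim
            · exact ((h1.trans h2).trans hxa).false.elim
        refine ⟨a, (hW a ha).1 hxa, hxa, haJ, had, le_of_lt ?_⟩
        rw [k5 a (hWC a ((hW a ha).1 hxa))]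
        exact fun b hb hxb => hag.trans_le ((hG.le_smul g).2 (hmin' b hb hxb))

open Classical in
/-- A power of an extension of `g` moves `x` beyond all points of `W` that lie before the next fixed
point of `g`. -/
theorem exists_climb {K W : Finset M} {J : Set M} (hJ : IsCell K J) (n : ℕ) :
    ∀ {A : Finset M} {g : G} {x : M}, FixedOn K g A → Separated J g A → x ∈ J → UpAt J g A x →
    (x ∈ A → g • x ≠ x) → (∀ a ∈ A, (x < a → a ∈ W) ∧ (x < g • a → g • a ∈ W)) →
    (W.filter fun c => x < c ∧ c ∈ J ∧ ∀ d ∈ A, g • d = d → x < d → c < d).card ≤ n →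
    ∃ (g' : G) (A' : Finset M) (N : ℕ), Extends g A g' A' ∧ Separated J g' A' ∧
      NoNewFixed A g' A' ∧ (∀ a ∈ A', a ∈ A ∨ a ∈ J) ∧ (∀ i ≤ N, g' ^ i • x ∈ A') ∧
      ∀ c ∈ W, c ∈ J → (∀ d ∈ A, g • d = d → x < d → c < d) → c < g' ^ (N + 1) • x := by
  induction n with
  | zero =>
    intro A g x hK hs hx hup hxf hW hcard
    obtain ⟨g', h1, h2, h3, h4, -⟩ := hG.exists_climb_step hJ hK hs hx hup hxf hW
    refine ⟨g', insert x A, 0, h1, h2, h3, ?_, fun i hi => ?_, fun c hc hcJ hcd => ?_⟩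
    · exact fun a ha => (Finset.mem_insert.1 ha).elim (fun h => Or.inr (by rwa [h])) Or.inl
    · rw [Nat.le_zero.1 hi, pow_zero, one_smul]
      exact Finset.mem_insert_self _ _
    · rw [zero_add, pow_one]
      by_contra! h
      have : c ∈ W.filter fun c => x < c ∧ c ∈ J ∧ ∀ d ∈ A, g • d = d → x < d → c < d :=
        Finset.mem_filter.2 ⟨hc, h4.trans_le h, hcJ, hcd⟩
      rw [Finset.card_eq_zero.1 (Nat.le_zero.1 hcard)] at this
      exact Finset.notMem_empty _ this
  | succ n ih =>
    intro A g x hK hs hx hup hxf hW hcard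
    obtain ⟨g₁, h1, h2, h3, h4, h5⟩ := hG.exists_climb_step hJ hK hs hx hup hxf hW
    -- The induction counts the points still to be passed: none is added by a step, and the step
    -- passes one of them if there are any.
    have hsub : (W.filter fun c => g₁ • x < c ∧ c ∈ J ∧
        ∀ d ∈ insert x A, g₁ • d = d → g₁ • x < d → c < d) ⊆
        W.filter fun c => x < c ∧ c ∈ J ∧ ∀ d ∈ A, g • d = d → x < d → c < d := by
      intro c hc
      obtain ⟨hc, q1, q2, q3⟩ := Finset.mem_filter.1 hc
      refine Finset.mem_filter.2 ⟨hc, h4.trans q1, q2, fun d hd hdg hxd => ?_⟩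
      have hdg' : g₁ • d = d := by rw [h1.2 d hd, hdg]
      exact q3 d (h1.1 hd) hdg' ((hG.smul_lt_iff_of_fixed hdg').2 hxd)
    have hlt : (W.filter fun c => g₁ • x < c ∧ c ∈ J ∧
        ∀ d ∈ insert x A, g₁ • d = d → g₁ • x < d → c < d).card ≤ n := by
      by_cases hne : (W.filter fun c => x < c ∧ c ∈ J ∧
          ∀ d ∈ A, g • d = d → x < d → c < d).Nonempty
      · obtain ⟨c, hc⟩ := hne
        obtain ⟨hc, q1, q2, q3⟩ := Finset.mem_filter.1 hc
        obtain ⟨c', hc', r1, r2, r3, r4⟩ := h5 c hc q1 q2 q3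
        refine Nat.le_of_lt_succ (lt_of_lt_of_le (Finset.card_lt_card ?_) hcard)
        refine Finset.ssubset_iff_subset_ne.2 ⟨hsub, fun heq => ?_⟩
        have : c' ∈ W.filter fun c => x < c ∧ c ∈ J ∧ ∀ d ∈ A, g • d = d → x < d → c < d :=
          Finset.mem_filter.2 ⟨hc', r1, r2, r3⟩
        rw [← heq] at this
        exact ((Finset.mem_filter.1 this).2.1.trans_le r4).false
      · rw [Finset.not_nonempty_iff_eq_empty.1 hne] at hsub
        rw [Finset.subset_empty.1 hsub]
        simp
    obtain ⟨g₂, A₂, N, k1, k2, k3, k6, k4, k5⟩ := ih (hK.extends h1) h2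
      ((hG.smul_mem_cell hJ (hK.extends h1)).2 hx) (hG.upAt_smul h1.2 hup h4)
      (fun _ h => h4.ne' (MulAction.injective g₁ h)) (by
        intro a ha
        rcases Finset.mem_insert.1 ha with rfl | ha
        · exact ⟨fun h => (h.trans h4).false.elim, fun h => h.false.elim⟩
        · rw [h1.2 a ha]
          exact ⟨fun h => (hW a ha).1 (h4.trans h), fun h => (hW a ha).2 (h4.trans h)⟩) hlt
    have hx2 : g₂ • x = g₁ • x := k1.2 x (Finset.mem_insert_self _ _)
    refine ⟨g₂, A₂, N + 1, h1.trans k1, k2, h3.trans k1 k3, ?_, fun i hi => ?_,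
      fun c hc hcJ hcd => ?_⟩
    · refine fun a ha => (k6 a ha).elim (fun h => ?_) Or.inr
      exact (Finset.mem_insert.1 h).elim (fun h => Or.inr (by rwa [h])) Or.inl
    · rcases i with _ | i
      · rw [pow_zero, one_smul]
        exact k1.1 (Finset.mem_insert_self _ _)
      · rw [pow_succ, mul_smul, hx2]
        exact k4 i (by omega)
    · rw [pow_succ, mul_smul, hx2]
      refine k5 c hc hcJ fun d hd hdg hxd => ?_
      have hdA := h3 d hd hdg
      exact hcd d hdA (by rw [← h1.2 d hdA, hdg]) ((hG.smul_lt_iff_of_fixed hdg).1 hxd)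

/-- Extending `(g, A)` so that the first `n + 1` powers are defined on `P`. -/
theorem exists_iterate {K : Finset M} {J : Set M} (hJ : IsCell K J) (n : ℕ) :
    ∀ {A : Finset M} {g : G} (P W : Finset M), FixedOn K g A → Separated J g A →
    ∃ (g' : G) (A' : Finset M), Extends g A g' A' ∧ Separated J g' A' ∧ NoNewFixed A g' A' ∧
      (∀ i ≤ n, ∀ b ∈ P, g' ^ i • b ∈ A') ∧
      ∀ e ∈ P, e ∉ J → Escapes K A e → Escapes K W (g' ^ (n + 1) • e) := by
  induction n with
  | zero =>
    intro A g P W hK hs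
    obtain ⟨g', h1, h2, h3, h4, -⟩ := hG.exists_extension_finset hJ hK hs P W
    refine ⟨g', A ∪ P, h1, h2, h3, fun i hi b hb => ?_, by simpa using h4⟩
    rw [Nat.le_zero.1 hi, pow_zero, one_smul]
    exact Finset.mem_union_right _ hb
  | succ n ih =>
    intro A g P W hK hs
    -- The set to escape from is the new domain `A ∪ P`, so that the images satisfy the hypothesis
    -- of the next iteration.
    obtain ⟨g₁, h1, h2, h3, h4, -⟩ := hG.exists_extension_finset hJ hK hs P (A ∪ P)
    obtain ⟨g₂, A₂, k1, k2, k3, k4, k5⟩ := ih (P.image (g₁ • ·)) W (hK.extends h1) h2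
    have hb2 : ∀ b ∈ P, g₂ • b = g₁ • b := fun b hb => k1.2 b (Finset.mem_union_right _ hb)
    refine ⟨g₂, A₂, h1.trans k1, k2, h3.trans k1 k3, fun i hi b hb => ?_, fun e he heJ hesc => ?_⟩
    · rcases i with _ | i
      · rw [pow_zero, one_smul]
        exact k1.1 (Finset.mem_union_right _ hb)
      · rw [pow_succ, mul_smul, hb2 b hb]
        exact k4 i (by omega) _ (Finset.mem_image_of_mem _ hb)
    · rw [pow_succ, mul_smul, hb2 e he]
      exact k5 _ (Finset.mem_image_of_mem _ he)
        (fun h => heJ ((hG.smul_mem_cell hJ (hK.extends h1)).1 h)) (h4 e he heJ hesc)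

open Classical in
/-- A block with positive exponent. -/
theorem exists_block_pos {K A : Finset M} {J : Set M} {g : G} {x : M} (hJ : IsCell K J)
    (hK : FixedOn K g A) (hs : Separated J g A) (P W : Finset M) (hx : x ∈ J)
    (hup : (x ∈ A → g • x ≠ x) → UpAt J g A x) :
    ∃ (g' : G) (A' : Finset M) (N : ℕ), Extends g A g' A' ∧ Separated J g' A' ∧
      NoNewFixed A g' A' ∧ DeterminesPow g' A' N P ∧
      (∀ e ∈ P, e ∉ J → Escapes K A e → Escapes K W (g' ^ N • e)) ∧
      ((x ∈ A → g • x ≠ x) → ∀ c ∈ W, c ∈ J → (∀ d ∈ A, g • d = d → x < d → c < d) →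
        c < g' ^ N • x) := by
  by_cases hxf : x ∈ A → g • x ≠ x
  · obtain ⟨g₁, A₁, N, h1, h2, h3, h6, h4, h5⟩ := hG.exists_climb
      (W := W ∪ A ∪ A.image (g • ·)) hJ _ hK hs hx (hup hxf) hxf
      (fun a ha => ⟨fun _ => by simp [ha], fun _ => Finset.mem_union_right _
        (Finset.mem_image_of_mem _ ha)⟩) le_rfl
    -- The climb of `x` determines the exponent `N + 1`; the other points of `P` are then carried
    -- along for as many steps.
    obtain ⟨g₂, A₂, k1, k2, k3, k4, k5⟩ := hG.exists_iterate hJ N P W (hK.extends h1) h2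
    refine ⟨g₂, A₂, N + 1, h1.trans k1, k2, h3.trans k1 k3, fun b hb h hh => ?_,
      fun e he heJ hesc => ?_, fun _ c hc hcJ hcd => ?_⟩
    · exact_mod_cast pow_smul_eq_of_agree hh (N + 1) fun i hi => k4 i (by omega) b hb
    · refine k5 e he heJ fun c hc hec => ?_
      -- The climb adds only points of `J` to the domain; a point `e` outside `J` and below one of
      -- them has a point of `K` in between.
      rcases h6 c hc with hcA | hcJ
      · exact hesc c hcA hec
      · have hlt : e < c := lt_of_le_of_ne hec (by rintro rfl; exact heJ hcJ)
        obtain ⟨k, hk, q1, q2⟩ := hJ.lt_left hcJ heJ hlt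
        refine ⟨k, hk, lt_of_le_of_ne q1 ?_, q2.le⟩
        rintro rfl
        exact hesc.notMem (hK _ hk).1
    · rw [pow_smul_eq_of_agree k1.2 (N + 1) fun i hi => h4 i (by omega)]
      exact h5 c (by simp [hc]) hcJ hcd
  -- Here `x` is fixed and the climbing clause is vacuous, so the exponent `1` does.
  · obtain ⟨g₂, A₂, k1, k2, k3, k4, k5⟩ := hG.exists_iterate hJ 0 P W hK hs
    refine ⟨g₂, A₂, 1, k1, k2, k3, fun b hb h hh => ?_, by simpa using k5, fun h => (hxf h).elim⟩
    exact_mod_cast pow_smul_eq_of_agree hh 1 fun i hi => k4 i (by omega) b hb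

open Classical in
/-- A block: a power of an extension of `g` is defined on `P`, keeps points that have escaped off `J`
escaping, and moves `x ∈ J` beyond all points of `W` that lie before the next fixed point. -/
theorem exists_block {K A : Finset M} {J : Set M} {g : G} {x : M} (hJ : IsCell K J)
    (hK : FixedOn K g A) (hs : Separated J g A) (P W : Finset M) (hx : x ∈ J) :
    ∃ (g' : G) (A' : Finset M) (n : ℤ), Extends g A g' A' ∧ Separated J g' A' ∧
      NoNewFixed A g' A' ∧ DeterminesPow g' A' n P ∧
      (∀ e ∈ P, e ∉ J → Escapes K (A ∪ A.image (g • ·)) e → Escapes K W (g' ^ n • e)) ∧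
      ((x ∈ A → g • x ≠ x) → ∀ c ∈ W, c ∈ J → (∀ d ∈ A, g • d = d → x < d → c < d) →
        c < g' ^ n • x) := by
  by_cases hup : (x ∈ A → g • x ≠ x) → UpAt J g A x
  · obtain ⟨g', A', N, h1, h2, h3, h4, h5, h6⟩ := hG.exists_block_pos hJ hK hs P W hx hup
    refine ⟨g', A', N, h1, h2, h3, h4, fun e he heJ hesc => ?_, ?_⟩
    · rw [zpow_natCast]
      exact h5 e he heJ (hesc.mono Finset.subset_union_left)
    · rw [zpow_natCast]
      exact h6
  -- Now the inverse pushes `x` up. Its domain is the range of `g` on `A`, which is why escape is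
  -- measured against domain and range together.
  · push Not at hup
    obtain ⟨hxf, hup⟩ := hup
    have hdown : DownAt J g A x := by
      by_cases hxA : x ∈ A
      · rcases lt_trichotomy x (g • x) with h | h | h
        · exact (hup (hs x hxA hx h)).elim
        · exact (hxf hxA h.symm).elim
        · intro a ha haJ hag
          obtain ⟨d, hd, hdg, hdb⟩ := hs a ha haJ hag x hxA hx h
          exact ⟨d, hd, hdg, hdb.symm⟩
      · exact hs.downAt hxA hup
    obtain ⟨h, B, N, h1, h2, h3, h4, h5, h6⟩ := hG.exists_block_pos hJ hK.inv
      (hG.separated_inv hJ hK hs) P W hx fun _ => hG.upAt_inv hJ hK hdown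
    refine ⟨h⁻¹, B.image (h • ·), -N, h1.of_inv, hG.separated_inv hJ (hK.inv.extends h1) h2,
      h3.of_inv h1, h4.of_inv, fun e he heJ hesc => ?_, fun _ c hc hcJ hcd => ?_⟩
    · rw [inv_zpow', neg_neg, zpow_natCast]
      exact h5 e he heJ (hesc.mono Finset.subset_union_right)
    · rw [inv_zpow', neg_neg, zpow_natCast]
      refine h6 (fun hxA h => ?_) c hc hcJ fun d hd hdg hxd => ?_
      · obtain ⟨a, ha, hax⟩ := Finset.mem_image.1 hxA
        rw [inv_smul_eq_iff] at h
        have : a = x := MulAction.injective g (hax.trans h)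
        exact hxf (this ▸ ha) h.symm
      · obtain ⟨a, ha, had⟩ := Finset.mem_image.1 hd
        rw [inv_smul_eq_iff] at hdg
        have : a = d := MulAction.injective g (had.trans hdg)
        exact hcd d (this ▸ ha) hdg.symm hxd

/-- Adding a fixed point to a partial automorphism, just beyond an orbit. -/
theorem exists_fixed {K A : Finset M} {J : Set M} {g : G} {a : M} (hJ : IsCell K J)
    (hK : FixedOn K g A) (haJ : a ∈ J) (hag : g • a ≠ a) (W : Finset M) :
    ∃ (z : M) (g' : G), z ∉ W ∧ z ∉ A ∧ z ∈ J ∧ a < z ∧ (∀ c ∈ A, g' • c = g • c) ∧ g' • z = z ∧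
      ∀ c ∈ A, c < z ↔ ∃ n : ℤ, c < g ^ n • a := by
  -- The cut below the orbit of `a` is invariant under `g`, and `z` is generic relative to `∅`, so
  -- fixing `z` is consistent with `(g, A)`.
  obtain ⟨r, -, h1, h2, h3⟩ := hG.ext ∅ (insert a (W ∪ A ∪ A.image (g • ·))) a
    (fun c => ∃ n : ℤ, c < g ^ n • a) (Finset.empty_subset _) (Finset.notMem_empty _)
    (fun c _ c' _ hcc ⟨n, hn⟩ => ⟨n, hcc.trans_lt hn⟩) (by simp)
  set z := r • a
  have hzA : z ∉ A := fun h => h1 (by simp [h])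
  have hA : ∀ c ∈ A, c < z ↔ ∃ n : ℤ, c < g ^ n • a := fun c hc => h2 c (by simp [hc])
  have haz : a < z := by
    rw [h2 a (Finset.mem_insert_self _ _)]
    rcases lt_or_gt_of_ne hag with h | h
    · refine ⟨-1, ?_⟩
      rw [← hG.lt_smul g, zpow_neg_one, smul_inv_smul]
      exact h
    · exact ⟨1, by simpa using h⟩
  obtain ⟨g', k1, k2⟩ := hG.exists_extension_id g (A := A) (E := {z}) (R := ∅) (by simp)
    (by
      intro e he
      rw [Finset.mem_singleton.1 he]
      refine ⟨hzA, fun c hc h => h1 ?_⟩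
      rw [← h]
      exact Finset.mem_insert_of_mem (Finset.mem_union_right _ (Finset.mem_image_of_mem _ hc)))
    (by
      intro c hc e he
      rw [Finset.mem_singleton.1 he, hA c hc,
        h2 (g • c) (Finset.mem_insert_of_mem (Finset.mem_union_right _
          (Finset.mem_image_of_mem _ hc)))]
      constructor
      · rintro ⟨n, hn⟩
        refine ⟨n + 1, ?_⟩
        rw [add_comm, zpow_add, mul_smul, zpow_one, hG.lt_smul]
        exact hn
      · rintro ⟨n, hn⟩
        refine ⟨n - 1, ?_⟩
        rw [← hG.lt_smul g, ← mul_smul, ← zpow_one_add]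
        simpa using hn)
    (by
      rw [Finset.coe_singleton]
      refine h3.mono (by simp) ?_
      rintro c (hc | ⟨c, hc, rfl⟩)
      · simp [Finset.mem_coe.1 hc]
      · exact Finset.mem_coe.2 (Finset.mem_insert_of_mem (Finset.mem_union_right _
          (Finset.mem_image_of_mem _ hc))))
  refine ⟨z, g', fun h => h1 (by simp [h]), hzA, ?_, haz, k1, k2 z (by simp), hA⟩
  by_contra hzJ
  obtain ⟨k, hk, q1, q2⟩ := hJ.lt_right haJ hzJ haz
  have hkz : k < z := lt_of_le_of_ne q2 (by rintro rfl; exact hzA (hK _ hk).1)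
  rw [hA k (hK k hk).1] at hkz
  obtain ⟨n, hn⟩ := hkz
  rw [hG.lt_smul_iff_of_fixed (zpow_smul_eq_self (hK k hk).2 n)] at hn
  exact (hn.trans q1).false

/-- When `a` moves up and `b` down, forward iterates of `a` stay below those of `b`, hence below
`b`, and backward iterates stay below `a`. Inversion gives the other case. So a point inserted just
beyond the orbit of `a` comes before `b`. -/
theorem not_lt_zpow_smul {g : G} {a b : M} (hab : a < b)
    (h : (a < g • a ∧ g • b < b) ∨ (g • a < a ∧ b < g • b)) (n : ℤ) : ¬ b < g ^ n • a := by
  have key : ∀ f : G, (a < f • a ∧ f • b < b) → ∀ n : ℕ, a ≤ f ^ n • a ∧ f ^ n • b ≤ b := by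
    rintro f ⟨h1, h2⟩ n
    induction n with
    | zero => simp
    | succ n ih =>
      simp only [pow_succ', mul_smul]
      exact ⟨h1.le.trans ((hG.le_smul f).2 ih.1), ((hG.le_smul f).2 ih.2).trans h2.le⟩
  have key2 : ∀ f : G, (a < f • a ∧ f • b < b) → ∀ n : ℤ, ¬ b < f ^ n • a := by
    intro f hf n hn
    obtain ⟨m, rfl | rfl⟩ := n.eq_nat_or_neg
    · rw [zpow_natCast] at hn
      have := hn.trans ((hG.lt_smul (f ^ m)).2 hab)
      exact (this.trans_le (key f hf m).2).false
    · rw [zpow_neg, zpow_natCast, ← hG.lt_smul (f ^ m), smul_inv_smul] at hn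
      have h1 := (hG.lt_smul (f ^ m)).2 hab
      exact ((h1.trans hn).trans_le (key f hf m).1).false
  rcases h with h | ⟨h1, h2⟩
  · exact key2 g h n
  · have := key2 g⁻¹ ⟨by rwa [← hG.lt_smul g, smul_inv_smul], by rwa [← hG.lt_smul g, smul_inv_smul]⟩
      (-n)
    rwa [inv_zpow', neg_neg] at this

/-- By adding fixed points in the cell `J`, a partial automorphism becomes separated. -/
theorem exists_separated {K A : Finset M} {J : Set M} {g : G} (hJ : IsCell K J)
    (hK : FixedOn K g A) (W : Finset M) :
    ∃ (g' : G) (A' : Finset M), Extends g A g' A' ∧ Separated J g' A' ∧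
      ∀ c ∈ A', c ∈ A ∨ (c ∈ J ∧ c ∉ W ∧ g' • c = c) := by
  -- All added points are fixed, so only pairs from the original `A` need separating; a fixed point
  -- beyond the orbit of the lower one does it.
  suffices H : ∀ B : Finset M, B ⊆ A → ∃ (g' : G) (A' : Finset M), Extends g A g' A' ∧
      (∀ c ∈ A', c ∈ A ∨ (c ∈ J ∧ c ∉ W ∧ g' • c = c)) ∧
      ∀ a ∈ B, a ∈ J → ∀ b ∈ A, a < b → ((a < g • a ∧ g • b < b) ∨ (g • a < a ∧ b < g • b)) →
        ∃ z ∈ A', g' • z = z ∧ a < z ∧ z < b by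
    obtain ⟨g', A', h1, h2, h3⟩ := H A subset_rfl
    refine ⟨g', A', h1, ?_, h2⟩
    intro a ha haJ hag b hb hbJ hbg
    have haA : a ∈ A := (h2 a ha).resolve_right fun h => (h.2.2 ▸ hag).false
    have hbA : b ∈ A := (h2 b hb).resolve_right fun h => (h.2.2 ▸ hbg).false
    rw [h1.2 a haA] at hag
    rw [h1.2 b hbA] at hbg
    rcases lt_trichotomy a b with h | rfl | h
    · obtain ⟨z, hz, hzg, q1, q2⟩ := h3 a haA haJ b hbA h (Or.inl ⟨hag, hbg⟩)
      exact ⟨z, hz, hzg, Or.inl ⟨q1, q2⟩⟩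
    · exact (hag.trans hbg).false.elim
    · obtain ⟨z, hz, hzg, q1, q2⟩ := h3 b hbA hbJ a haA h (Or.inr ⟨hbg, hag⟩)
      exact ⟨z, hz, hzg, Or.inr ⟨q1, q2⟩⟩
  intro B
  induction B using Finset.induction_on with
  | empty => exact fun _ => ⟨g, A, Extends.refl g A, fun c hc => Or.inl hc, by simp⟩
  | insert a B _ ih =>
    intro hB
    obtain ⟨g₁, A₁, h1, h2, h3⟩ := ih ((Finset.subset_insert _ _).trans hB)
    have haA : a ∈ A := hB (Finset.mem_insert_self _ _)
    by_cases ha : a ∈ J ∧ g₁ • a ≠ a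
    · obtain ⟨z, g₂, k1, k2, k3, k4, k5, k6, k7⟩ := hG.exists_fixed hJ (hK.extends h1) ha.1 ha.2 W
      have hE : Extends g₁ A₁ g₂ (insert z A₁) := ⟨Finset.subset_insert _ _, k5⟩
      refine ⟨g₂, insert z A₁, h1.trans hE, ?_, ?_⟩
      · intro c hc
        rcases Finset.mem_insert.1 hc with rfl | hc
        · exact Or.inr ⟨k3, k1, k6⟩
        · rw [k5 c hc]
          exact h2 c hc
      · intro a' ha' ha'J b hb hab hopp
        rcases Finset.mem_insert.1 ha' with rfl | ha'
        · refine ⟨z, Finset.mem_insert_self _ _, k6, k4, ?_⟩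
          have hbA : b ∈ A₁ := h1.1 hb
          refine lt_of_le_of_ne (not_lt.1 ?_) (by rintro rfl; exact k2 hbA)
          rw [k7 b hbA]
          rintro ⟨n, hn⟩
          rw [← h1.2 a' haA, ← h1.2 b hb] at hopp
          exact hG.not_lt_zpow_smul hab hopp n hn
        · obtain ⟨y, hy, q1, q2⟩ := h3 a' ha' ha'J b hb hab hopp
          exact ⟨y, Finset.mem_insert_of_mem hy, by rw [k5 y hy, q1], q2⟩
    · refine ⟨g₁, A₁, h1, h2, fun a' ha' ha'J b hb hab hopp => ?_⟩
      rcases Finset.mem_insert.1 ha' with rfl | ha'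
      · have : g₁ • a' = a' := by
          by_contra h; exact ha ⟨ha'J, h⟩
        rw [← h1.2 a' haA, this] at hopp
        simp at hopp
      · exact h3 a' ha' ha'J b hb hab hopp

end GenericOrderedAction

/-! ### Words in two partial automorphisms: making points escape -/

theorem fin_two_eq_or (i j : Fin 2) : i = j ∨ i = j + 1 := by revert i j; decide

theorem fin_two_add_one_ne (j : Fin 2) : j + 1 ≠ j := by revert j; decide

theorem fin_two_add_one_add_one (j : Fin 2) : j + 1 + 1 = j := by revert j; decide

variable {ι : Type*}

/-- The pair of partial automorphisms `(f, A)` can be extended to `(f', A')` in such a way that some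
word moves the points `b` to the points `b'`. -/
def Reaches (f : Fin 2 → G) (A : Fin 2 → Finset M) (b : ι → M) (f' : Fin 2 → G)
    (A' : Fin 2 → Finset M) (b' : ι → M) : Prop :=
  (∀ j, Extends (f j) (A j) (f' j) (A' j)) ∧ ∃ u : FreeGroup (Fin 2), ∀ h : Fin 2 → G,
    (∀ j, ∀ a ∈ A' j, h j • a = f' j • a) → ∀ i, FreeGroup.lift h u • b i = b' i

omit [LinearOrder M] in
theorem Reaches.of_extends {f f' : Fin 2 → G} {A A' : Fin 2 → Finset M}
    (h : ∀ j, Extends (f j) (A j) (f' j) (A' j)) (b : ι → M) : Reaches f A b f' A' b :=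
  ⟨h, 1, fun _ _ _ => by simp⟩

omit [LinearOrder M] in
theorem Reaches.trans {f₁ f₂ f₃ : Fin 2 → G} {A₁ A₂ A₃ : Fin 2 → Finset M} {b₁ b₂ b₃ : ι → M}
    (h : Reaches f₁ A₁ b₁ f₂ A₂ b₂) (h' : Reaches f₂ A₂ b₂ f₃ A₃ b₃) :
    Reaches f₁ A₁ b₁ f₃ A₃ b₃ := by
  obtain ⟨h1, u, hu⟩ := h
  obtain ⟨h2, v, hv⟩ := h'
  refine ⟨fun j => (h1 j).trans (h2 j), v * u, fun g hg i => ?_⟩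
  rw [map_mul, mul_smul, hu g (fun j a ha => ?_) i, hv g hg i]
  rw [hg j a ((h2 j).1 ha), (h2 j).2 a ha]

omit [LinearOrder M] in
theorem lift_smul_eq_self {f : Fin 2 → G} {d : M} (h : ∀ j, f j • d = d) (u : FreeGroup (Fin 2)) :
    FreeGroup.lift f u • d = d := by
  induction u using FreeGroup.induction_on with
  | C1 => simp
  | of j => simpa using h j
  | inv_of j _ => rw [map_inv, inv_smul_eq_iff]; simpa using (h j).symm
  | mul u v hu hv => rw [map_mul, mul_smul, hv, hu]

-- Every word fixes `K` pointwise and acts injectively.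
omit [LinearOrder M] in
theorem Reaches.notMem {K : Finset M} {f f' : Fin 2 → G} {A A' : Fin 2 → Finset M} {b b' : ι → M}
    (h : Reaches f A b f' A' b') (hK : ∀ j, FixedOn K (f j) (A j)) (hb : ∀ i, b i ∉ K) (i : ι) :
    b' i ∉ K := by
  obtain ⟨h1, u, hu⟩ := h
  intro hi
  have h2 := lift_smul_eq_self (f := f') (d := b' i)
    (fun j => ((hK j).extends (h1 j) _ hi).2) u
  rw [← hu f' (fun _ _ _ => rfl) i] at h2
  rw [← hu f' (fun _ _ _ => rfl) i, MulAction.injective _ h2] at hi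
  exact hb i hi

omit [LinearOrder M] in
theorem Reaches.of_determinesPow [Fintype ι] [DecidableEq M] {f : Fin 2 → G}
    {A : Fin 2 → Finset M} {b : ι → M}
    {j : Fin 2} {g' : G} {A' : Finset M} {n : ℤ} (h : Extends (f j) (A j) g' A')
    (hd : ∀ i, ∀ h : G, (∀ a ∈ A', h • a = g' • a) → h ^ n • b i = g' ^ n • b i) :
    Reaches f A b (Function.update f j g') (Function.update A j A') (fun i => g' ^ n • b i) := by
  refine ⟨fun i => ?_, FreeGroup.of j ^ n, fun h hh i => ?_⟩
  · rcases eq_or_ne i j with rfl | hij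
    · simpa using h
    · simpa [hij] using Extends.refl (f i) (A i)
  · rw [map_zpow, FreeGroup.lift_apply_of]
    refine hd i (h j) fun a ha => ?_
    have := hh j a
    simp only [Function.update_self] at this
    exact this ha

/-- The domain and range of the `j`-th partial automorphism. -/
def support (f : Fin 2 → G) (A : Fin 2 → Finset M) (j : Fin 2) : Finset M :=
  A j ∪ (A j).image (f j • ·)

/-- A pair of partial automorphisms with common fixed points `K`. -/
structure FixesExactly (K : Finset M) (f : Fin 2 → G) (A : Fin 2 → Finset M) : Prop where
  fixed : ∀ j, FixedOn K (f j) (A j)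
  common : ∀ d, (∀ j, d ∈ A j ∧ f j • d = d) → d ∈ K

omit [LinearOrder M] in
theorem FixesExactly.of_noNewFixed {K : Finset M} {f f' : Fin 2 → G} {A A' : Fin 2 → Finset M}
    (h : FixesExactly K f A) (he : ∀ j, Extends (f j) (A j) (f' j) (A' j))
    (hn : ∀ j, NoNewFixed (A j) (f' j) (A' j)) : FixesExactly K f' A' where
  fixed j := (h.fixed j).extends (he j)
  common d hd := h.common d fun j => by
    have h1 := hn j d (hd j).1 (hd j).2
    exact ⟨h1, by rw [← (he j).2 d h1, (hd j).2]⟩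

/-- The fixed points of the `j`-th partial automorphism in `J`. -/
def IsFixedIn (J : Set M) (f : Fin 2 → G) (A : Fin 2 → Finset M) (j : Fin 2) (d : M) : Prop :=
  d ∈ J ∧ d ∈ A j ∧ f j • d = d

/-- The first fixed point in `J` from `x` on, if there is any, is not fixed by the `j`-th partial
automorphism. -/
def NextIsOther (J : Set M) (f : Fin 2 → G) (A : Fin 2 → Finset M) (j : Fin 2) (x : M) : Prop :=
  ∀ v, IsFixedIn J f A j v → x ≤ v → ∃ v', IsFixedIn J f A (j + 1) v' ∧ x ≤ v' ∧ v' < v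

namespace GenericOrderedAction

variable (hG : GenericOrderedAction G rel δ)
include hG

open Classical in
/-- One block of the word that makes the points in the cell `J` escape. -/
theorem exists_turn [Fintype ι] {K : Finset M} {J : Set M} {f : Fin 2 → G}
    {A : Fin 2 → Finset M} {b : ι → M} {i₀ : ι} {S : Set ι} (hJ : IsCell K J)
    (hK : FixesExactly K f A) (hs : ∀ j, Separated J (f j) (A j)) (hx : b i₀ ∈ J)
    (hmin : ∀ i, b i ∈ J → b i₀ ≤ b i) (j : Fin 2)
    (hS : ∀ i ∈ S, b i ∉ J ∧ Escapes K (support f A j) (b i)) :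
    ∃ (f' : Fin 2 → G) (A' : Fin 2 → Finset M) (b' : ι → M), Reaches f A b f' A' b' ∧
      FixesExactly K f' A' ∧ (∀ j, Separated J (f' j) (A' j)) ∧
      (∀ i d, IsFixedIn J f' A' i d ↔ IsFixedIn J f A i d) ∧
      (∀ i, b' i ∈ J ↔ b i ∈ J) ∧ (∀ i, b' i ∈ J → b' i₀ ≤ b' i) ∧
      (∀ i ∈ S, Escapes K (support f' A' (j + 1)) (b' i)) ∧
      ((∀ i, b i ∈ J → Escapes K (support f' A' (j + 1)) (b' i)) ∨
        (NextIsOther J f' A' (j + 1) (b' i₀) ∧ (NextIsOther J f A j (b i₀) →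
          ∃ v, IsFixedIn J f A (j + 1) v ∧ b i₀ ≤ v ∧ v < b' i₀))) := by
  -- The points to pass include the other generator's domain, for its fixed points, and its full
  -- support, for the final escape.
  obtain ⟨g', B, n, h1, h2, h3, h4, h5, h6⟩ := hG.exists_block hJ (hK.fixed j) (hs j)
    (Finset.univ.image b) (A (j + 1) ∪ support f A (j + 1)) hx
  have hP : ∀ i, b i ∈ Finset.univ.image b := fun i =>
    Finset.mem_image_of_mem _ (Finset.mem_univ i)
  have hR := Reaches.of_determinesPow (b := b) h1 (fun i => h4 _ (hP i))
  set f' := Function.update f j g' with hf'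
  set A' := Function.update A j B with hA'
  have hf'j : f' j = g' := Function.update_self j g' f
  have hA'j : A' j = B := Function.update_self j B A
  have hf'j1 : f' (j + 1) = f (j + 1) := Function.update_of_ne (fin_two_add_one_ne j) _ _
  have hA'j1 : A' (j + 1) = A (j + 1) := Function.update_of_ne (fin_two_add_one_ne j) _ _
  have hext : ∀ i, Extends (f i) (A i) (f' i) (A' i) := hR.1
  have hnew : ∀ i, NoNewFixed (A i) (f' i) (A' i) := by
    intro i
    rcases fin_two_eq_or i j with rfl | rfl
    · rw [hf'j, hA'j]; exact h3
    · rw [hf'j1, hA'j1]; exact fun _ h _ => h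
  have hK' : FixesExactly K f' A' := hK.of_noNewFixed hext hnew
  have hfix : ∀ i d, IsFixedIn J f' A' i d ↔ IsFixedIn J f A i d := by
    intro i d
    constructor
    · rintro ⟨q1, q2, q3⟩
      have := hnew i d q2 q3
      exact ⟨q1, this, by rw [← (hext i).2 d this, q3]⟩
    · rintro ⟨q1, q2, q3⟩
      exact ⟨q1, (hext i).1 q2, by rw [(hext i).2 d q2, q3]⟩
  have hKg : FixedOn K (g' ^ n) K := fun k hk =>
    ⟨hk, zpow_smul_eq_self ((hK.fixed j).extends h1 k hk).2 n⟩
  have hmem : ∀ i, g' ^ n • b i ∈ J ↔ b i ∈ J := fun i => hG.smul_mem_cell hJ hKg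
  have hsupp : support f' A' (j + 1) = support f A (j + 1) := by
    simp only [support, hf'j1, hA'j1]
  have hnotcommon : ∀ {d}, IsFixedIn J f A j d → ¬ IsFixedIn J f A (j + 1) d := by
    rintro d ⟨q1, q2⟩ ⟨_, q3⟩
    refine hJ.notMem d (hK.common d fun i => ?_) q1
    rcases fin_two_eq_or i j with rfl | rfl
    exacts [q2, q3]
  refine ⟨f', A', fun i => g' ^ n • b i, hR, hK', ?_, hfix, hmem, fun i hi => ?_, fun i hi => ?_, ?_⟩
  · intro i
    rcases fin_two_eq_or i j with rfl | rfl
    · rw [hf'j, hA'j]; exact h2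
    · rw [hf'j1, hA'j1]; exact hs _
  · exact (hG.le_smul _).2 (hmin i ((hmem i).1 hi))
  · rw [hsupp]
    exact (h5 _ (hP i) (hS i hi).1 (hS i hi).2).mono Finset.subset_union_right
  by_cases hxf : b i₀ ∈ A j → f j • b i₀ ≠ b i₀
  · have h6 := h6 hxf
    have hout : ∀ {c d}, c ∈ J → d ∉ J → b i₀ < d → c < d := by
      intro c d hc hd hlt
      obtain ⟨k, hk, q1, q2⟩ := hJ.lt_right hx hd hlt
      exact (hJ.side hx hc hk q1).trans_le q2
    -- With a fixed point of the `j`-th map ahead in `J`, the block stops before the least one,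
    -- having passed all earlier fixed points of the other map. With none ahead, it passes all of
    -- the other support in `J`.
    by_cases hd : ((A j).filter fun d => IsFixedIn J f A j d ∧ b i₀ < d).Nonempty
    · right
      obtain ⟨d, hd, hdmin⟩ := Finset.exists_minimal hd
      simp only [Finset.mem_filter, and_imp] at hd hdmin
      obtain ⟨-, hdf, hxd⟩ := hd
      have hpass : ∀ v, IsFixedIn J f A (j + 1) v → v < d → v < g' ^ n • b i₀ := by
        intro v hv hvd
        refine h6 v (Finset.mem_union_left _ hv.2.1) hv.1 fun d' hd' hdg' hxd' => ?_
        by_cases hd'J : d' ∈ J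
        · rcases le_or_gt d d' with h | h
          · exact hvd.trans_le h
          · exact (h.trans_le (hdmin hd' ⟨hd'J, hd', hdg'⟩ hxd' h.le)).false.elim
        · exact hout hv.1 hd'J hxd'
      have hdn : g' ^ n • d = d :=
        zpow_smul_eq_self (by rw [h1.2 d hdf.2.1, hdf.2.2]) n
      refine ⟨fun v hv hxv => ⟨d, ?_, ?_, ?_⟩, fun hnext => ?_⟩
      · rw [hfix, fin_two_add_one_add_one]; exact hdf
      · exact ((hG.smul_lt_iff_of_fixed hdn).2 hxd).le
      · rw [hfix] at hv
        rcases lt_trichotomy d v with h | rfl | h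
        · exact h
        · exact (hnotcommon hdf hv).elim
        · exact ((hpass v hv h).trans_le hxv).false.elim
      · obtain ⟨v, hv, q1, q2⟩ := hnext d hdf hxd.le
        exact ⟨v, hv, q1, hpass v hv q2⟩
    · left
      intro i hi c hc hle
      rw [hsupp] at hc
      by_cases hcJ : c ∈ J
      · have hcx : c < g' ^ n • b i₀ := by
          refine h6 c (Finset.mem_union_right _ hc) hcJ fun d' hd' hdg' hxd' => ?_
          refine hout hcJ (fun hd'J => hd ⟨d', ?_⟩) hxd'
          exact Finset.mem_filter.2 ⟨hd', ⟨hd'J, hd', hdg'⟩, hxd'⟩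
        exact ((hcx.trans_le ((hG.le_smul _).2 (hmin i hi))).trans_le hle).false.elim
      · refine hJ.lt_right ((hmem i).2 hi) hcJ (lt_of_le_of_ne hle ?_)
        rintro rfl
        exact hcJ ((hmem i).2 hi)
  -- The least point is itself fixed by the `j`-th map, so it stays and is the next fixed point for
  -- the other map; `NextIsOther` for `j` is then contradictory.
  · right
    push Not at hxf
    have hxn : g' ^ n • b i₀ = b i₀ := zpow_smul_eq_self (by rw [h1.2 _ hxf.1, hxf.2]) n
    have hxF : IsFixedIn J f A j (b i₀) := ⟨hx, hxf⟩
    refine ⟨fun v hv hxv => ⟨b i₀, ?_, hxn.le, ?_⟩, fun hnext => ?_⟩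
    · rw [hfix, fin_two_add_one_add_one]; exact hxF
    · rw [hfix] at hv
      simp only [hxn] at hxv
      refine lt_of_le_of_ne hxv ?_
      rintro rfl
      exact hnotcommon hxF hv
    · obtain ⟨v, _, q1, q2⟩ := hnext _ hxF le_rfl
      exact (q1.trans_lt q2).false.elim

-- Each turn, with the generators alternating, passes a fixed point of the generator not in use and
-- restores the invariant for it, so the number of points of `V` still ahead drops until the cell is
-- left behind.
open Classical in
theorem exists_escape_of_nextIsOther [Fintype ι] {K V : Finset M} {J : Set M} {i₀ : ι} {S : Set ι}
    (hJ : IsCell K J) (n : ℕ) :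
    ∀ {f : Fin 2 → G} {A : Fin 2 → Finset M} {b : ι → M}, FixesExactly K f A →
    (∀ j, Separated J (f j) (A j)) → b i₀ ∈ J → (∀ i, b i ∈ J → b i₀ ≤ b i) →
    (∀ j d, IsFixedIn J f A j d → d ∈ V) →
    ∀ j : Fin 2, (∀ i ∈ S, b i ∉ J ∧ Escapes K (support f A j) (b i)) →
    NextIsOther J f A j (b i₀) → (V.filter (b i₀ ≤ ·)).card < n →
    ∃ (f' : Fin 2 → G) (A' : Fin 2 → Finset M) (b' : ι → M) (j' : Fin 2),
      Reaches f A b f' A' b' ∧ FixesExactly K f' A' ∧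
      ∀ i, i ∈ S ∨ b i ∈ J → Escapes K (support f' A' j') (b' i) := by
  induction n with
  | zero => exact fun _ _ _ _ _ _ _ _ h => (Nat.not_lt_zero _ h).elim
  | succ n ih =>
    intro f A b hK hs hx hmin hV j hS hnext hcard
    obtain ⟨f₁, A₁, b₁, h1, h2, h3, h4, h5, h6, h7, h8⟩ := hG.exists_turn hJ hK hs hx hmin j hS
    rcases h8 with h8 | ⟨h8, h9⟩
    · exact ⟨f₁, A₁, b₁, j + 1, h1, h2, fun i hi => hi.elim (h7 i) (h8 i)⟩
    · obtain ⟨v, hv, hxv, hvx⟩ := h9 hnext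
      obtain ⟨f₂, A₂, b₂, j₂, k1, k2, k3⟩ := ih h2 h3 ((h5 i₀).2 hx) h6
        (fun j d hd => hV j d ((h4 j d).1 hd)) (j + 1)
        (fun i hi => ⟨fun h => (hS i hi).1 ((h5 i).1 h), h7 i hi⟩) h8 (by
          refine lt_of_lt_of_le (Finset.card_lt_card ?_) (Nat.le_of_lt_succ hcard)
          refine (Finset.ssubset_iff_of_subset fun d hd => ?_).2 ⟨v, ?_, ?_⟩
          · rw [Finset.mem_filter] at hd ⊢
            exact ⟨hd.1, (hxv.trans hvx.le).trans hd.2⟩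
          · exact Finset.mem_filter.2 ⟨hV _ v hv, hxv⟩
          · simp [hvx])
      refine ⟨f₂, A₂, b₂, j₂, h1.trans k1, k2, fun i hi => k3 i ?_⟩
      rwa [h5]

open Classical in
/-- The least point that does not escape can be made to escape. -/
theorem exists_escape_one [Fintype ι] {K : Finset M} {f : Fin 2 → G} {A : Fin 2 → Finset M}
    {b : ι → M} {i₀ : ι} (hK : FixesExactly K f A) (hb : ∀ i, b i ∉ K) (j : Fin 2)
    (hi₀ : ¬ Escapes K (support f A j) (b i₀))
    (hmin : ∀ i, ¬ Escapes K (support f A j) (b i) → b i₀ ≤ b i) :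
    ∃ (f' : Fin 2 → G) (A' : Fin 2 → Finset M) (b' : ι → M) (j' : Fin 2),
      Reaches f A b f' A' b' ∧ FixesExactly K f' A' ∧
      ∀ i, i = i₀ ∨ Escapes K (support f A j) (b i) → Escapes K (support f' A' j') (b' i) := by
  set J := cell K (b i₀)
  have hJ : IsCell K J := isCell_cell (hb i₀)
  have hx : b i₀ ∈ J := mem_cell_self K _
  have hmin' : ∀ i, b i ∈ J → b i₀ ≤ b i := by
    intro i hi
    by_contra! hlt
    have hesc : Escapes K (support f A j) (b i) := by
      by_contra h
      exact (hlt.trans_le (hmin i h)).false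
    refine hi₀ fun c hc hle => ?_
    obtain ⟨k, hk, q1, q2⟩ := hesc c hc (hlt.le.trans hle)
    exact ⟨k, hk, hJ.side hi hx hk q1, q2⟩
  -- New fixed points of the first map avoid `A 1`, and those of the second avoid `B₀`, so no new
  -- common fixed point arises.
  obtain ⟨g₀, B₀, p1, p2, p3⟩ := hG.exists_separated hJ (hK.fixed 0) (A 1)
  obtain ⟨g₁, B₁, q1, q2, q3⟩ := hG.exists_separated hJ (hK.fixed 1) B₀
  set f₁ : Fin 2 → G := ![g₀, g₁]
  set A₁ : Fin 2 → Finset M := ![B₀, B₁]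
  have hext : ∀ i, Extends (f i) (A i) (f₁ i) (A₁ i) := Fin.forall_fin_two.2 ⟨p1, q1⟩
  have hsep : ∀ i, Separated J (f₁ i) (A₁ i) := Fin.forall_fin_two.2 ⟨p2, q2⟩
  have hold : ∀ i, ∀ c ∈ A₁ i, c ∈ A i ∨ (c ∈ J ∧ f₁ i • c = c) :=
    Fin.forall_fin_two.2 ⟨fun c hc => (p3 c hc).imp_right fun h => ⟨h.1, h.2.2⟩,
      fun c hc => (q3 c hc).imp_right fun h => ⟨h.1, h.2.2⟩⟩
  have hK₁ : FixesExactly K f₁ A₁ := by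
    refine ⟨fun i => (hK.fixed i).extends (hext i), fun d hd => ?_⟩
    obtain ⟨hd0, hd1⟩ := Fin.forall_fin_two.1 hd
    have hdA1 : d ∈ A 1 := (q3 d hd1.1).resolve_right fun h => h.2.1 hd0.1
    have hdA0 : d ∈ A 0 := (p3 d hd0.1).resolve_right fun h => h.2.1 hdA1
    refine hK.common d (Fin.forall_fin_two.2 ⟨⟨hdA0, ?_⟩, ⟨hdA1, ?_⟩⟩)
    · rw [← p1.2 d hdA0]; exact hd0.2
    · rw [← q1.2 d hdA1]; exact hd1.2
  set S : Set ι := {i | b i ∉ J ∧ Escapes K (support f A j) (b i)} with hSdef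
  have hS : ∀ i ∈ S, b i ∉ J ∧ Escapes K (support f₁ A₁ j) (b i) := by
    rintro i ⟨hi, hesc⟩
    refine ⟨hi, fun c hc hle => ?_⟩
    have hc' : c ∈ support f A j ∨ c ∈ J := by
      rcases Finset.mem_union.1 hc with hc | hc
      · exact (hold j c hc).imp (fun h => Finset.mem_union_left _ h) fun h => h.1
      · obtain ⟨a, ha, rfl⟩ := Finset.mem_image.1 hc
        rcases hold j a ha with h | ⟨h, h'⟩
        · left
          rw [(hext j).2 a h]
          exact Finset.mem_union_right _ (Finset.mem_image_of_mem _ h)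
        · right
          rwa [h']
    rcases hc' with hc' | hc'
    · exact hesc c hc' hle
    · obtain ⟨k, hk, r1, r2⟩ := hJ.lt_left hc' hi (lt_of_le_of_ne hle fun h => hi (h ▸ hc'))
      exact ⟨k, hk, lt_of_le_of_ne r1 fun h => hb i (h ▸ hk), r2.le⟩
  -- This preliminary turn either finishes or establishes `NextIsOther`, the invariant of the
  -- alternation.
  obtain ⟨f₂, A₂, b₂, h1, h2, h3, h4, h5, h6, h7, h8⟩ :=
    hG.exists_turn hJ hK₁ hsep hx hmin' j hS
  have hcase : ∀ i, i = i₀ ∨ Escapes K (support f A j) (b i) → i ∈ S ∨ b i ∈ J := by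
    rintro i (rfl | hi)
    · exact Or.inr hx
    · by_cases hiJ : b i ∈ J
      · exact Or.inr hiJ
      · exact Or.inl ⟨hiJ, hi⟩
  have hR := (Reaches.of_extends hext b).trans h1
  rcases h8 with h8 | ⟨h8, -⟩
  · exact ⟨f₂, A₂, b₂, j + 1, hR, h2, fun i hi => (hcase i hi).elim (h7 i) (h8 i)⟩
  · obtain ⟨f₃, A₃, b₃, j₃, k1, k2, k3⟩ := hG.exists_escape_of_nextIsOther (V := A₂ 0 ∪ A₂ 1) hJ _
      h2 h3 ((h5 i₀).2 hx) h6
      (by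
        intro i d hd
        rcases fin_two_eq_or i 0 with rfl | rfl
        · exact Finset.mem_union_left _ hd.2.1
        · exact Finset.mem_union_right _ hd.2.1) (j + 1)
      (fun i hi => ⟨fun h => (hS i hi).1 ((h5 i).1 h), h7 i hi⟩) h8 (Nat.lt_succ_self _)
    refine ⟨f₃, A₃, b₃, j₃, hR.trans k1, k2, fun i hi => k3 i ?_⟩
    rw [h5]
    exact hcase i hi

open Classical in
/-- All points can be made to escape simultaneously. -/
theorem exists_escape [Fintype ι] {K : Finset M} (n : ℕ) :
    ∀ {f : Fin 2 → G} {A : Fin 2 → Finset M} {b : ι → M}, FixesExactly K f A → (∀ i, b i ∉ K) →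
    ∀ j : Fin 2, (Finset.univ.filter fun i => ¬ Escapes K (support f A j) (b i)).card ≤ n →
    ∃ (f' : Fin 2 → G) (A' : Fin 2 → Finset M) (b' : ι → M) (j' : Fin 2),
      Reaches f A b f' A' b' ∧ FixesExactly K f' A' ∧ ∀ i, Escapes K (support f' A' j') (b' i) := by
  have hdone : ∀ {f : Fin 2 → G} {A : Fin 2 → Finset M} {b : ι → M} {j : Fin 2},
      FixesExactly K f A →
      ¬ (Finset.univ.filter fun i => ¬ Escapes K (support f A j) (b i)).Nonempty →
      ∃ (f' : Fin 2 → G) (A' : Fin 2 → Finset M) (b' : ι → M) (j' : Fin 2),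
      Reaches f A b f' A' b' ∧ FixesExactly K f' A' ∧
        ∀ i, Escapes K (support f' A' j') (b' i) := by
    intro f A b j hK hne
    refine ⟨f, A, b, j, Reaches.of_extends (fun _ => Extends.refl _ _) b, hK, fun i => ?_⟩
    by_contra h
    exact hne ⟨i, by simp [h]⟩
  induction n with
  | zero =>
    intro f A b hK _ j hcard
    refine hdone (j := j) hK ?_
    rw [Finset.card_eq_zero.1 (Nat.le_zero.1 hcard)]
    exact Finset.not_nonempty_empty
  | succ n ih =>
    intro f A b hK hb j hcard
    by_cases hne : (Finset.univ.filter fun i => ¬ Escapes K (support f A j) (b i)).Nonempty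
    · obtain ⟨i₀, hi₀, hmin⟩ := Finset.exists_min_image _ b hne
      simp only [Finset.mem_filter, Finset.mem_univ, true_and] at hi₀ hmin
      obtain ⟨f₁, A₁, b₁, j₁, h1, h2, h3⟩ := hG.exists_escape_one hK hb j hi₀ hmin
      obtain ⟨f₂, A₂, b₂, j₂, k1, k2, k3⟩ := ih h2 (h1.notMem hK.fixed hb) j₁ (by
        refine Nat.le_of_lt_succ (lt_of_lt_of_le (Finset.card_lt_card ?_) hcard)
        refine (Finset.ssubset_iff_of_subset fun i hi => ?_).2 ⟨i₀, ?_, ?_⟩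
        · simp only [Finset.mem_filter, Finset.mem_univ, true_and] at hi ⊢
          exact fun h => hi (h3 i (Or.inr h))
        · simpa using hi₀
        · simpa using h3 i₀ (Or.inl rfl))
      exact ⟨f₂, A₂, b₂, j₂, h1.trans k1, k2, k3⟩
    · exact hdone hK hne

end GenericOrderedAction

/-! ### Making escaped points generic, and the word -/

namespace GenericOrderedAction

variable (hG : GenericOrderedAction G rel δ)
include hG

theorem lt_pow_smul {f : G} {c : M} (h : c < f • c) (n : ℕ) : c < f ^ (n + 1) • c := by
  induction n with
  | zero => simpa using h
  | succ n ih =>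
    rw [pow_succ', mul_smul]
    exact h.trans ((hG.lt_smul f).2 ih)

theorem pow_smul_lt {f : G} {c : M} (h : f • c < c) (n : ℕ) : f ^ (n + 1) • c < c := by
  induction n with
  | zero => simpa using h
  | succ n ih =>
    rw [pow_succ', mul_smul]
    exact ((hG.lt_smul f).2 ih).trans h

/-- A point moved up, or down, by an order-preserving map continues in that direction and never
returns. -/
theorem smul_eq_of_pow_smul_eq {f : G} {c : M} {n : ℕ} (h : f ^ (n + 1) • c = c) : f • c = c := by
  rcases lt_trichotomy c (f • c) with h1 | h1 | h1
  · exact ((hG.lt_pow_smul h1 n).ne' h).elim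
  · exact h1.symm
  · exact ((hG.pow_smul_lt h1 n).ne h).elim

/-- A point whose backward orbit remains long enough in a finite set is fixed. -/
theorem fixed_of_inv_pow_mem {g : G} {A : Finset M} {c : M}
    (h : ∀ i < A.card + 1, g⁻¹ ^ (i + 1) • c ∈ A) : c ∈ A ∧ g • c = c := by
  obtain ⟨i, hi, j, hj, hij, heq⟩ := Finset.exists_ne_map_eq_of_card_lt_of_maps_to
    (s := Finset.range (A.card + 1)) (t := A) (by simp)
    (f := fun i => g⁻¹ ^ (i + 1) • c) (fun i hi => h i (Finset.mem_range.1 hi))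
  have key : ∀ i k : ℕ, g⁻¹ ^ (i + 1) • c = g⁻¹ ^ (i + k + 1 + 1) • c → g⁻¹ • c = c := by
    intro i k hik
    refine hG.smul_eq_of_pow_smul_eq (n := k) ?_
    have : i + k + 1 + 1 = (i + 1) + (k + 1) := by ring
    rw [this, pow_add _ (i + 1), mul_smul] at hik
    exact (MulAction.injective _ hik).symm
  have hfix : g⁻¹ • c = c := by
    rcases lt_or_gt_of_ne hij with hlt | hlt
    · obtain ⟨k, rfl⟩ := Nat.exists_eq_add_of_lt hlt
      exact key i k heq
    · obtain ⟨k, rfl⟩ := Nat.exists_eq_add_of_lt hlt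
      exact key j k heq.symm
  have h0 := h 0 (Nat.succ_pos _)
  rw [zero_add, pow_one, hfix] at h0
  exact ⟨h0, (inv_smul_eq_iff.1 hfix).symm⟩

/-- Genericity of `P` is transported to its image by an extension of `(g, A)` for which the image is
generic relative to the range. -/
theorem genericOver_image {g g' : G} {A : Finset M} {P R W₀ W : Set M}
    (hA : ∀ a ∈ A, g' • a = g • a) (hAW : (A : Set M) ⊆ W₀) (hP : GenericOver rel δ P R W₀)
    (hP' : GenericOver rel δ ((g' • ·) '' P) ((g • ·) '' (A : Set M)) W) :
    GenericOver rel δ ((g' • ·) '' P) ((g • ·) '' (R ∩ A)) W := by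
  intro n r x hx hE hR
  -- A tuple leaving the range is governed by the genericity of the new images; any other is the
  -- `g'`-image of a tuple from `A ∪ P`, governed by that of `P`.
  by_cases hran : ∃ k, x k ∉ (g • ·) '' (A : Set M) ∪ (g' • ·) '' P
  · exact hP' n r x hx hE hran
  · push Not at hran
    have hpre : ∀ k, ∃ y, (y ∈ A ∨ y ∈ P) ∧ g' • y = x k := by
      intro k
      rcases hran k with ⟨a, ha, h⟩ | ⟨a, ha, h⟩
      · exact ⟨a, Or.inl ha, by rw [← h]; exact hA a ha⟩
      · exact ⟨a, Or.inr ha, h⟩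
    choose y hy hyx using hpre
    obtain rfl : (fun k => g' • y k) = x := funext hyx
    have hset : {k | g' • y k ∈ (g' • ·) '' P} = {k | y k ∈ P} := by
      ext k
      exact (MulAction.injective g').mem_set_image
    rw [hG.rel_smul, hset]
    refine hP n r y (fun k => ?_) ?_ ?_
    · rcases hy k with h | h
      · exact Or.inl (hAW h)
      · exact Or.inr h
    · obtain ⟨k, hk⟩ := hE
      exact ⟨k, (MulAction.injective g').mem_set_image.1 hk⟩
    · obtain ⟨k, hk⟩ := hR
      refine ⟨k, fun h => hk ?_⟩
      rcases hy k with h' | h'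
      · rcases h with h | h
        · exact Or.inl ⟨y k, ⟨h, h'⟩, (hA _ h').symm⟩
        · exact Or.inr ⟨y k, h, rfl⟩
      · exact Or.inr ⟨y k, h', rfl⟩

open Classical in
theorem exists_generic_iterate {K A : Finset M} {g : G} (hK : FixedOn K g A) (P W : Finset M)
    (R : Set M) (hesc : ∀ e ∈ P, Escapes K (A ∪ A.image (g • ·)) e)
    (hgen : GenericOver rel δ (P : Set M) R A) (n : ℕ) :
    ∃ (g' : G) (A' : Finset M), Extends g A g' A' ∧ (∀ i < n, ∀ b ∈ P, g' ^ i • b ∈ A') ∧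
      (∀ a ∈ A', a ∈ A ∨ (0 < n ∧ a ∉ A.image (g • ·))) ∧
      (∀ e ∈ P, Escapes K (A' ∪ A.image (g • ·)) (g' ^ n • e)) ∧
      GenericOver rel δ ((g' ^ n • ·) '' (P : Set M))
        {c | g⁻¹ ^ n • c ∈ R ∧ ∀ i < n, g⁻¹ ^ (i + 1) • c ∈ A} A' ∧
      (0 < n → (∀ e ∈ P, Escapes K W (g' ^ n • e)) ∧
        GenericOver rel δ ((g' ^ n • ·) '' (P : Set M))
          {c | g⁻¹ ^ n • c ∈ R ∧ ∀ i < n, g⁻¹ ^ (i + 1) • c ∈ A} W) := by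
  -- After `n` steps the exceptional points are those whose `n` successive `g⁻¹`-images stay in `A`,
  -- the last one being in `R`.
  induction n with
  | zero =>
    exact ⟨g, A, Extends.refl g A, by simp, fun a ha => Or.inl ha, by simpa using hesc,
      by simpa using hgen, fun h => h.false.elim⟩
  | succ n ih =>
    obtain ⟨g₁, A₁, h1, h2, h3, h4, h5, -⟩ := ih
    set Q := P.image (g₁ ^ n • ·) with hQ
    have hQP : ∀ e ∈ P, g₁ ^ n • e ∈ Q := fun e he => Finset.mem_image_of_mem _ he
    obtain ⟨g₂, k1, -, -, k4, k5⟩ := hG.exists_extension_finset (J := ∅) (P := Q)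
      (W := W ∪ (A₁ ∪ Q) ∪ A.image (g • ·)) (IsCell.empty K) (hK.extends h1)
      (fun _ _ h => h.elim)
    have hpow : ∀ e ∈ P, g₂ ^ (n + 1) • e = g₂ • g₁ ^ n • e := fun e he => by
      rw [pow_succ', mul_smul, pow_smul_eq_of_agree (fun a ha =>
        k1.2 a ha) n fun i hi => h2 i hi e he]
    have hesc' : ∀ e ∈ P, Escapes K (W ∪ (A₁ ∪ Q) ∪ A.image (g • ·)) (g₂ ^ (n + 1) • e) := by
      intro e he
      rw [hpow e he]
      exact k4 _ (hQP e he) (fun h => h.elim) ((h4 e he).mono Finset.subset_union_left)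
    have himg : (g₂ ^ (n + 1) • ·) '' (P : Set M) = (g₂ • ·) '' (Q : Set M) := by
      rw [hQ, Finset.coe_image, Set.image_image]
      exact Set.image_congr fun e he => hpow e he
    have hgen' : GenericOver rel δ ((g₂ ^ (n + 1) • ·) '' (P : Set M))
        {c | g⁻¹ ^ (n + 1) • c ∈ R ∧ ∀ i < n + 1, g⁻¹ ^ (i + 1) • c ∈ A}
        (W ∪ (A₁ ∪ Q) ∪ A.image (g • ·) : Finset M) := by
      rw [himg]
      have hgen₁ := hG.genericOver_image (fun a ha => k1.2 a (ha)) subset_rfl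
        (P := Q) (by rw [hQ, Finset.coe_image]; exact h5) (k5 fun e he h => by
          obtain ⟨e', he', rfl⟩ := Finset.mem_image.1 he
          exact (h4 e' he').notMem (Finset.mem_union_left _ h))
      refine hgen₁.mono ?_ subset_rfl
      rintro _ ⟨a, ⟨⟨ha1, ha2⟩, ha3⟩, rfl⟩
      -- A point added to the domain lies outside the range of `g` on `A`, whereas for `0 < n` the
      -- point `a` has a preimage in `A`.
      have haA : a ∈ A := by
        refine (h3 a ha3).resolve_right fun ⟨hn, h⟩ => h ?_
        have := ha2 0 hn
        rw [zero_add, pow_one] at this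
        exact Finset.mem_image.2 ⟨_, this, smul_inv_smul g a⟩
      have hshift : ∀ m : ℕ, g⁻¹ ^ (m + 1) • g • a = g⁻¹ ^ m • a := fun m => by
        rw [pow_succ, mul_smul, inv_smul_smul]
      rw [show (fun x => g₁ • x) a = g • a from h1.2 a haA]
      refine ⟨by rw [hshift]; exact ha1, fun i hi => ?_⟩
      rw [hshift]
      rcases i with _ | i
      · simpa using haA
      · exact ha2 i (by omega)
    refine ⟨g₂, A₁ ∪ Q, h1.trans k1, ?_, ?_, ?_, ?_, fun _ => ⟨?_, ?_⟩⟩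
    · intro i hi b hb
      rw [pow_smul_eq_of_agree (fun a ha => k1.2 a ha) i fun i' hi' => h2 i' (by omega) b hb]
      rcases Nat.lt_succ_iff_lt_or_eq.1 hi with hi | rfl
      · exact Finset.mem_union_left _ (h2 i hi b hb)
      · exact Finset.mem_union_right _ (hQP b hb)
    · intro a ha
      rcases Finset.mem_union.1 ha with ha | ha
      · exact (h3 a ha).imp_right fun h => ⟨Nat.succ_pos n, h.2⟩
      · obtain ⟨e, he, rfl⟩ := Finset.mem_image.1 ha
        exact Or.inr ⟨Nat.succ_pos n, fun h => (h4 e he).notMem (Finset.mem_union_right _ h)⟩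
    · exact fun e he => (hesc' e he).mono
        (Finset.union_subset_union_left Finset.subset_union_right)
    · exact hgen'.mono subset_rfl (by
        intro c hc
        simp only [Finset.coe_union] at hc ⊢
        exact Or.inl (Or.inr hc))
    · exact fun e he => (hesc' e he).mono
        (Finset.subset_union_left.trans Finset.subset_union_left)
    · exact hgen'.mono subset_rfl (by
        intro c hc
        simp only [Finset.coe_union]
        exact Or.inl (Or.inl hc))

/-- A power of an extension of `g` makes the points of `P` generic relative to fixed points of `g`. -/
theorem exists_generic_block {K A : Finset M} {g : G} (hK : FixedOn K g A) (P W : Finset M)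
    (R : Set M) (hesc : ∀ e ∈ P, Escapes K (A ∪ A.image (g • ·)) e)
    (hgen : GenericOver rel δ (P : Set M) R A) :
    ∃ (g' : G) (A' : Finset M) (n : ℤ), Extends g A g' A' ∧ DeterminesPow g' A' n P ∧
      (∀ e ∈ P, Escapes K W (g' ^ n • e)) ∧
      GenericOver rel δ ((g' ^ n • ·) '' (P : Set M)) {c | c ∈ R ∧ c ∈ A ∧ g • c = c} W := by
  -- `A.card + 1` backward steps inside `A` force a repetition, so every exceptional point is fixed.
  obtain ⟨g', A', h1, h2, -, -, -, h6⟩ :=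
    hG.exists_generic_iterate hK P W R hesc hgen (A.card + 1)
  obtain ⟨h6, h7⟩ := h6 (Nat.succ_pos _)
  refine ⟨g', A', (A.card + 1 : ℕ), h1, fun b hb h hh => ?_, by simpa only [zpow_natCast] using h6, ?_⟩
  · rw [zpow_natCast, zpow_natCast]
    exact pow_smul_eq_of_agree hh _ fun i hi => h2 i hi b hb
  · simp only [zpow_natCast]
    refine h7.mono (fun c hc => ?_) subset_rfl
    obtain ⟨q1, q2⟩ := hc
    obtain ⟨q3, q4⟩ := hG.fixed_of_inv_pow_mem q2
    refine ⟨?_, q3, q4⟩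
    have h8 := zpow_smul_eq_self (inv_smul_eq_iff.2 q4.symm) (A.card + 1 : ℕ)
    rw [zpow_natCast] at h8
    rwa [h8] at q1

open Classical in
/-- Escaping points can be made generic relative to the common fixed points. -/
theorem exists_generic [Fintype ι] {K : Finset M} {f : Fin 2 → G} {A : Fin 2 → Finset M}
    {b : ι → M} (hK : FixesExactly K f A) (j : Fin 2)
    (hesc : ∀ i, Escapes K (support f A j) (b i)) :
    ∃ (f' : Fin 2 → G) (A' : Fin 2 → Finset M) (b' : ι → M),
      Reaches f A b f' A' b' ∧ (∀ i, Escapes K (support f' A' j) (b' i)) ∧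
      GenericOver rel δ (Set.range b') K (support f' A' j) := by
  have hP : ∀ (b : ι → M) (i : ι), b i ∈ Finset.univ.image b := fun b i =>
    Finset.mem_image_of_mem _ (Finset.mem_univ i)
  have hrange : ∀ b : ι → M, ((Finset.univ.image b : Finset M) : Set M) = Set.range b := by
    intro b; simp
  obtain ⟨g₁, B₁, n₁, h1, h2, h3, h4⟩ := hG.exists_generic_block (hK.fixed j)
    (Finset.univ.image b) (support f A (j + 1)) Set.univ
    (fun e he => by
      obtain ⟨i, -, rfl⟩ := Finset.mem_image.1 he
      exact hesc i) (GenericOver.univ _ _)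
  have hR₁ := Reaches.of_determinesPow (b := b) h1 (fun i => h2 _ (hP b i))
  set f₁ := Function.update f j g₁
  set A₁ := Function.update A j B₁
  set b₁ := fun i => g₁ ^ n₁ • b i with hb₁
  have e1 : f₁ (j + 1) = f (j + 1) := Function.update_of_ne (fin_two_add_one_ne j) _ _
  have e2 : A₁ (j + 1) = A (j + 1) := Function.update_of_ne (fin_two_add_one_ne j) _ _
  have himg₁ : (g₁ ^ n₁ • ·) '' ((Finset.univ.image b : Finset M) : Set M) = Set.range b₁ := by
    rw [hrange, ← Set.range_comp]; rfl
  rw [himg₁] at h4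
  -- The first block left only fixed points of the `j`-th map as exceptions; this one intersects
  -- them with those of the other map, which leaves points of `K`.
  obtain ⟨g₂, B₂, n₂, k1, k2, k3, k4⟩ := hG.exists_generic_block
    (g := f₁ (j + 1)) (A := A₁ (j + 1)) ((hK.fixed (j + 1)).extends (hR₁.1 (j + 1)))
    (Finset.univ.image b₁) (support f₁ A₁ j) {c | c ∈ Set.univ ∧ c ∈ A j ∧ f j • c = c}
    (fun e he => by
      obtain ⟨i, -, rfl⟩ := Finset.mem_image.1 he
      rw [e1, e2]
      exact h3 _ (hP b i)) (by
      rw [hrange, e2]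
      exact h4.mono subset_rfl (by simp [support]))
  have hR₂ := Reaches.of_determinesPow (b := b₁) k1 (fun i => k2 _ (hP b₁ i))
  set f₂ := Function.update f₁ (j + 1) g₂
  set A₂ := Function.update A₁ (j + 1) B₂
  have hsupp : support f₂ A₂ j = support f₁ A₁ j := by
    have e3 : f₂ j = f₁ j := Function.update_of_ne (fin_two_add_one_ne j).symm _ _
    have e4 : A₂ j = A₁ j := Function.update_of_ne (fin_two_add_one_ne j).symm _ _
    simp only [support, e3, e4]
  refine ⟨f₂, A₂, _, hR₁.trans hR₂, fun i => ?_, ?_⟩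
  · rw [hsupp]
    exact k3 _ (hP b₁ i)
  · rw [hsupp]
    have himg₂ : (g₂ ^ n₂ • ·) '' ((Finset.univ.image b₁ : Finset M) : Set M) =
        Set.range fun i => g₂ ^ n₂ • b₁ i := by
      rw [hrange, ← Set.range_comp]; rfl
    rw [← himg₂]
    refine k4.mono ?_ subset_rfl
    rintro c ⟨⟨-, q1, q2⟩, q3, q4⟩
    rw [e2] at q3
    rw [e1] at q4
    refine hK.common c fun i => ?_
    rcases fin_two_eq_or i j with rfl | rfl
    exacts [⟨q1, q2⟩, ⟨q3, q4⟩]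

open Classical in
/-- Every pair of partial automorphisms has extensions such that some word fixes a given finite set
in the one and moves a given point in the other. -/
theorem exists_word (f : Fin 2 → G) (A : Fin 2 → Finset M) (F : Finset M) {x₀ : M}
    (hx₀ : f 0 • x₀ ≠ x₀) :
    ∃ (w : FreeGroup (Fin 2)) (f' f'' : Fin 2 → G), (∀ j, ∀ a ∈ A j, f' j • a = f j • a) ∧
      (∀ j, ∀ a ∈ A j, f'' j • a = f j • a) ∧ (∀ x ∈ F, FreeGroup.lift f' w • x = x) ∧
      FreeGroup.lift f'' w • x₀ ≠ x₀ := by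
  set K : Finset M := (A 0).filter fun d => ∀ j, d ∈ A j ∧ f j • d = d with hKdef
  have hKmem : ∀ d, d ∈ K ↔ ∀ j, d ∈ A j ∧ f j • d = d := fun d => by
    rw [hKdef, Finset.mem_filter]
    exact ⟨fun h => h.2, fun h => ⟨(h 0).1, h⟩⟩
  have hK : FixesExactly K f A :=
    ⟨fun j k hk => (hKmem k).1 hk j, fun d hd => (hKmem d).2 hd⟩
  have hx₀K : x₀ ∉ K := fun h => hx₀ ((hKmem x₀).1 h 0).2
  set b : {x // x ∈ (insert x₀ F).filter (· ∉ K)} → M := Subtype.val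
  have hb : ∀ i, b i ∉ K := fun i => (Finset.mem_filter.1 i.2).2
  obtain ⟨f₁, A₁, b₁, j, h1, h2, h3⟩ := hG.exists_escape _ hK hb 0 le_rfl
  obtain ⟨f₂, A₂, b₂, k1, k2, k3⟩ := hG.exists_generic h2 j h3
  obtain ⟨hext, u, hu⟩ := h1.trans k1
  have hKj : FixedOn K (f₂ j) (A₂ j) := (hK.fixed j).extends (hext j)
  have hnot : ∀ i, b₂ i ∉ A₂ j ∧ ∀ a ∈ A₂ j, f₂ j • a ≠ b₂ i := fun i =>
    ⟨fun h => (k2 i).notMem (Finset.mem_union_left _ h), fun a ha h =>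
      (k2 i).notMem (Finset.mem_union_right _ (Finset.mem_image.2 ⟨a, ha, h⟩))⟩
  -- The cuts are invariant: a support point above `b₂ i` is at or beyond a point of `K` above `b₂
  -- i`, and `f₂ j` respects that fixed point.
  obtain ⟨g', p1, p2⟩ := hG.exists_extension_id (f₂ j) (A := A₂ j) (E := Finset.univ.image b₂)
    (R := K)
    (by
      rintro a ha (h | h)
      · exact (hKj a h).2
      · exact MulAction.injective _ (hKj _ h).2)
    (fun e he => by
      obtain ⟨i, -, rfl⟩ := Finset.mem_image.1 he
      exact hnot i)
    (fun a ha e he => by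
      obtain ⟨i, -, rfl⟩ := Finset.mem_image.1 he
      constructor
      · intro h
        by_contra! hle
        obtain ⟨k, hk, q1, q2⟩ := k2 i (f₂ j • a)
          (Finset.mem_union_right _ (Finset.mem_image_of_mem _ ha)) hle
        rw [hG.le_smul_iff_of_fixed (hKj k hk).2] at q2
        exact (q1.trans_le (q2.trans h.le)).false
      · intro h
        by_contra! hle
        obtain ⟨k, hk, q1, q2⟩ := k2 i a (Finset.mem_union_left _ ha) hle
        rw [← hG.le_smul_iff_of_fixed (hKj k hk).2] at q2
        exact (q1.trans_le (q2.trans h.le)).false)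
    (by
      have : ((Finset.univ.image b₂ : Finset M) : Set M) = Set.range b₂ := by simp
      rw [this]
      exact k3.mono subset_rfl (by simp [support]))
  have hi₀ : x₀ ∈ (insert x₀ F).filter (· ∉ K) := by simp [hx₀K]
  -- Putting the carried point itself into `C` forces its image to differ from it.
  obtain ⟨g'', q1, q2, -⟩ := hG.exists_extension_high (f₂ j) (A := A₂ j) (b := b₂ ⟨x₀, hi₀⟩)
    (C := insert (b₂ ⟨x₀, hi₀⟩) ((A₂ j).image (f₂ j • ·))) (hnot _).1
    (fun a ha => Finset.mem_insert_of_mem (Finset.mem_image_of_mem _ ha))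
  have hagree : ∀ g : G, (∀ a ∈ A₂ j, g • a = f₂ j • a) → ∀ i, ∀ a ∈ A₂ i,
      Function.update f₂ j g i • a = f₂ i • a := by
    intro g hg i a ha
    rcases eq_or_ne i j with rfl | hij
    · simpa using hg a ha
    · simp [hij]
  have hold : ∀ g : G, (∀ a ∈ A₂ j, g • a = f₂ j • a) → ∀ i, ∀ a ∈ A i,
      Function.update f₂ j g i • a = f i • a := fun g hg i a ha => by
    rw [hagree g hg i a ((hext i).1 ha), (hext i).2 a ha]
  have hw : ∀ (h : Fin 2 → G) (x : M), FreeGroup.lift h (u⁻¹ * FreeGroup.of j * u) • x = x ↔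
      h j • FreeGroup.lift h u • x = FreeGroup.lift h u • x := by
    intro h x
    rw [map_mul, map_mul, map_inv, FreeGroup.lift_apply_of, mul_smul, mul_smul, inv_smul_eq_iff]
  refine ⟨u⁻¹ * FreeGroup.of j * u, Function.update f₂ j g', Function.update f₂ j g'',
    hold g' p1, hold g'' q1, fun x hx => ?_, ?_⟩
  · by_cases hxK : x ∈ K
    · refine lift_smul_eq_self (fun i => ?_) _
      rw [hold g' p1 i x ((hK.fixed i) x hxK).1, ((hK.fixed i) x hxK).2]
    · have hi : x ∈ (insert x₀ F).filter (· ∉ K) := by simp [hx, hxK]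
      have := hu _ (hagree g' p1) ⟨x, hi⟩
      rw [hw, show x = b ⟨x, hi⟩ from rfl, this, Function.update_self]
      exact p2 _ (Finset.mem_image_of_mem _ (Finset.mem_univ _))
  · have := hu _ (hagree g'' q1) ⟨x₀, hi₀⟩
    rw [ne_eq, hw, show x₀ = b ⟨x₀, hi₀⟩ from rfl, this, Function.update_self]
    exact fun h => q2 (by rw [h]; exact Finset.mem_insert_self _ _)

end GenericOrderedAction

end PartialAutomorphisms

/-! ### From ultrahomogeneous ordered structures to generic ordered actions -/

namespace FirstOrder.Language

section Homogeneous

open Structure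

variable {L : Language.{u, v}}

instance autMulAction (M : Type w) [L.Structure M] : MulAction (M ≃[L] M) M where
  smul g x := g x
  one_smul _ := rfl
  mul_smul _ _ _ := rfl

/-- The structure on `X` pulled back along a map to a structure in a relational language. -/
@[reducible]
def pullbackStructure [L.IsRelational] {X M : Type*} [L.Structure M] (φ : X → M) :
    L.Structure X where
  funMap f := isEmptyElim f
  RelMap r x := RelMap r (φ ∘ x)

theorem pullbackStructure_mem_age [L.IsRelational] {X M : Type w} [Finite X] [L.Structure M]
    {φ : X → M} (hφ : Function.Injective φ) :
    (⟨X, pullbackStructure φ⟩ : Bundled.{w} L.Structure) ∈ L.age M := by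
  let _ : L.Structure X := pullbackStructure φ
  refine ⟨Structure.fg_iff_finite.2 ‹_›, ⟨⟨⟨φ, hφ⟩, fun {n} f => isEmptyElim f, fun r x => ?_⟩⟩⟩
  exact Iff.rfl

variable {M : Type w} [(L.sum Language.order).Structure M]

/-- The relations of the reduct of an ordered structure. -/
def reductRel (L : Language.{u, v}) (M : Type w) [(L.sum Language.order).Structure M] (n : ℕ)
    (r : L.Relations n) (x : Fin n → M) : Prop :=
  RelMap (L := L.sum Language.order) (Sum.inl r) x

/-- A class `K` of structures has *generic one-point extensions* over `M`: a finite subset `C` of `M`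
and a one-point extension by `b` of a subset `A` of `C` have an amalgam in `K` with underlying set
`C ∪ {b}`, in which the relations between `b` and `C \ A` are prescribed by `δ`. -/
def HasGenericExtensions (K : Set (Bundled.{w} L.Structure)) (M : Type w)
    [(L.sum Language.order).Structure M] (δ : ∀ n, L.Relations n → Set (Fin n) → Prop) : Prop :=
  ∀ (A C : Finset M) (b : M), A ⊆ C → b ∉ A → ∃ s : L.Structure (Option C),
    (⟨Option C, s⟩ : Bundled.{w} L.Structure) ∈ K ∧
    (∀ n (r : L.Relations n) (x : Fin n → C),
      s.RelMap r (fun k => some (x k)) ↔ reductRel L M n r (fun k => x k)) ∧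
    (∀ n (r : L.Relations n) (x : Fin n → Option C) (y : Fin n → M),
      (∀ k, (∃ a : C, (a : M) ∈ A ∧ x k = some a ∧ y k = a) ∨ (x k = none ∧ y k = b)) →
      (s.RelMap r x ↔ reductRel L M n r y)) ∧
    (∀ n (r : L.Relations n) (x : Fin n → Option C), (∃ k, x k = none) →
      (∃ k, ∃ c : C, (c : M) ∉ A ∧ x k = some c) → (s.RelMap r x ↔ δ n r {k | x k = none}))

theorem relMap_inr_iff [LE M] [(L.sum Language.order).OrderedStructure M]
    (x : Fin 2 → M) :
    RelMap (L := L.sum Language.order) (Sum.inr (leSymb : Language.order.Relations 2)) x ↔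
      x 0 ≤ x 1 :=
  relMap_leSymb (L := L.sum Language.order) x

/-- In a relational language `X` generates only itself, so `κ` is an embedding of a finitely
generated substructure and ultrahomogeneity extends it. -/
theorem exists_equiv_of_partial [L.IsRelational] [LinearOrder M]
    [(L.sum Language.order).OrderedStructure M]
    (hM : (L.sum Language.order).IsUltrahomogeneous M) (X : Finset M) (κ : M → M)
    (hlt : ∀ a ∈ X, ∀ b ∈ X, a < b → κ a < κ b)
    (hrel : ∀ (n : ℕ) (r : L.Relations n) (x : Fin n → M), (∀ k, x k ∈ X) →
      (reductRel L M n r (fun k => κ (x k)) ↔ reductRel L M n r x)) :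
    ∃ g : M ≃[L.sum Language.order] M, ∀ a ∈ X, g • a = κ a := by
  set S := Substructure.closure (L.sum Language.order) (X : Set M) with hS
  have hmem : ∀ a : M, a ∈ S ↔ a ∈ X := fun a => by
    rw [hS, Substructure.mem_closure_iff_of_isRelational]; rfl
  have hle : ∀ a ∈ X, ∀ b ∈ X, κ a ≤ κ b ↔ a ≤ b := by
    intro a ha b hb
    constructor
    · intro h
      by_contra! h'
      exact ((hlt b hb a ha h').trans_le h).false
    · intro h
      rcases h.lt_or_eq with h | rfl
      · exact (hlt a ha b hb h).le
      · exact le_rfl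
  let F : S ↪[L.sum Language.order] M :=
    { toFun := fun a => κ a
      inj' := by
        intro a b hab
        have ha := (hmem a).1 a.2
        have hb := (hmem b).1 b.2
        exact Subtype.ext (le_antisymm ((hle a ha b hb).1 hab.le) ((hle b hb a ha).1 hab.ge))
      map_fun' := fun {n} f => isEmptyElim f
      map_rel' := by
        intro n r x
        have hx : ∀ k, (x k : M) ∈ X := fun k => (hmem _).1 (x k).2
        rcases r with r | r
        · exact hrel n r (fun k => x k) hx
        · cases r
          exact (relMap_inr_iff _).trans ((hle _ (hx 0) _ (hx 1)).trans
            (relMap_inr_iff (L := L) fun k => (x k : M)).symm) }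
  obtain ⟨g, hg⟩ := hM S (Substructure.fg_closure X.finite_toSet) F
  refine ⟨g, fun a ha => ?_⟩
  have := DFunLike.congr_fun hg ⟨a, (hmem a).2 ha⟩
  exact this.symm

/-- The age contains every linear ordering of a member of `K`, so the order of its copy in `M` can
be prescribed, here by `key`. -/
theorem exists_map_of_mem_class [LinearOrder M] [(L.sum Language.order).OrderedStructure M]
    {K : Set (Bundled.{w} L.Structure)} (hage : orderExpansion K ⊆ (L.sum Language.order).age M)
    {X : Type w} {Y : Type*} [LinearOrder Y] (key : X → Y) (hkey : Function.Injective key)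
    (s : L.Structure X) (hs : (⟨X, s⟩ : Bundled.{w} L.Structure) ∈ K) :
    ∃ e : X → M, Function.Injective e ∧ (∀ x y, e x < e y ↔ key x < key y) ∧
      ∀ n (r : L.Relations n) (x : Fin n → X),
        reductRel L M n r (fun k => e (x k)) ↔ s.RelMap r x := by
  let _ : LinearOrder X := LinearOrder.lift' key hkey
  let _ : Language.order.Structure X := orderStructure X
  have : (L.sum Language.order).OrderedStructure X := ⟨fun x => by
    have : x = ![x 0, x 1] := by ext i; fin_cases i <;> rfl
    rw [this]
    exact Iff.rfl⟩
  have hN : (⟨X, inferInstance⟩ : Bundled.{w} (L.sum Language.order).Structure) ∈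
      orderExpansion K := ⟨hs, model_linearOrder⟩
  obtain ⟨-, ⟨e⟩⟩ := hage hN
  refine ⟨e, e.injective, fun x y => ?_, fun n r x =>
    StrongHomClass.map_rel e (Sum.inl r : (L.sum Language.order).Relations n) x⟩
  have h := StrongHomClass.map_rel e
    (Sum.inr (leSymb : Language.order.Relations 2) : (L.sum Language.order).Relations 2) ![y, x]
  rw [relMap_inr_iff, relMap_inr_iff] at h
  rw [← not_le, ← not_le]
  exact not_congr h

theorem genericOrderedAction [L.IsRelational] [LinearOrder M]
    [(L.sum Language.order).OrderedStructure M] {K : Set (Bundled.{w} L.Structure)}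
    {δ : ∀ n, L.Relations n → Set (Fin n) → Prop}
    (hM : (L.sum Language.order).IsUltrahomogeneous M)
    (hage : orderExpansion K ⊆ (L.sum Language.order).age M)
    (hK : HasGenericExtensions K M δ)
    (hδ : ∀ (n : ℕ) (r : L.Relations n) (T T' : Set (Fin n)), T.Nonempty → T'.Nonempty →
      Disjoint T T' → (∃ k, k ∉ T ∪ T') → (δ n r T ↔ δ n r (T ∪ T'))) :
    GenericOrderedAction (M ≃[L.sum Language.order] M) (reductRel L M) δ := by
  have hle : ∀ (g : M ≃[L.sum Language.order] M) (a b : M), g • a ≤ g • b ↔ a ≤ b := by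
    intro g a b
    have h := StrongHomClass.map_rel g
      (Sum.inr (leSymb : Language.order.Relations 2) : (L.sum Language.order).Relations 2) ![a, b]
    rw [relMap_inr_iff, relMap_inr_iff] at h
    exact h
  have hlt : ∀ (g : M ≃[L.sum Language.order] M) {a b : M}, g • a < g • b ↔ a < b := by
    intro g a b
    rw [← not_le, ← not_le, hle]
  have hrel : ∀ (g : M ≃[L.sum Language.order] M) (n : ℕ) (r : L.Relations n) (x : Fin n → M),
      reductRel L M n r (fun k => g • x k) ↔ reductRel L M n r x := fun g n r x =>
    StrongHomClass.map_rel g (Sum.inl r : (L.sum Language.order).Relations n) x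
  refine ⟨hlt, hrel, exists_equiv_of_partial hM, ?_, hδ⟩
  intro A C b D hAC hb hD hA
  classical
  obtain ⟨s, hs, hsC, hsA, hsδ⟩ := hK A C b hAC hb
  -- The new point comes directly after the last point of `C` in `D`; the Boolean breaks the tie,
  -- and `⊥` serves when there is no such point.
  let key : Option C → WithBot M ×ₗ Bool := fun x => match x with
    | some c => toLex (((c : M) : WithBot M), false)
    | none => toLex ((C.filter D).max, true)
  have hkey : Function.Injective key := by
    rintro (_ | c) (_ | c') h
    · rfl
    · exact absurd (congrArg (fun p => (ofLex p).2) h) (by simp [key])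
    · exact absurd (congrArg (fun p => (ofLex p).2) h) (by simp [key])
    · have := congrArg (fun p => (ofLex p).1) h
      simp only [key, ofLex_toLex, WithBot.coe_inj] at this
      rw [Subtype.ext this]
  obtain ⟨e, he_inj, hlt_iff, he_rel⟩ := exists_map_of_mem_class hage key hkey s hs
  have hsome : ∀ c c' : C, (e (some c) < e (some c') ↔ (c : M) < c') := by
    intro c c'
    rw [hlt_iff]
    simp [key, Prod.Lex.toLex_lt_toLex]
  have hnone : ∀ c : C, (e (some c) < e none ↔ D c) := by
    intro c
    rw [hlt_iff]
    simp only [key, Prod.Lex.toLex_lt_toLex]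
    constructor
    · intro h
      have h' : ((c : M) : WithBot M) ≤ (C.filter D).max := h.elim (fun h => h.le) fun h => h.1.le
      obtain ⟨m, hm⟩ := WithBot.ne_bot_iff_exists.1
        (fun h0 : (C.filter D).max = ⊥ => by rw [h0] at h'; simp at h')
      rw [← hm, WithBot.coe_le_coe] at h'
      have hmD := Finset.mem_filter.1 (Finset.mem_of_max hm.symm)
      exact hD c c.2 m hmD.1 h' hmD.2
    · intro h
      have h' : ((c : M) : WithBot M) ≤ (C.filter D).max :=
        Finset.le_max (Finset.mem_filter.2 ⟨c.2, h⟩)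
      rcases h'.lt_or_eq with h' | h'
      · exact Or.inl h'
      · exact Or.inr ⟨h', by decide⟩
  have hCval : ∀ {c : M} (hc : c ∈ C),
      (if h : c ∈ C then e (some ⟨c, h⟩) else c) = e (some ⟨c, hc⟩) := fun hc => dif_pos hc
  -- The amalgam sits elsewhere in `M`; `σ` carries `C` onto its copy there, and `σ⁻¹` brings the
  -- new point back over `C`.
  obtain ⟨σ, hσ⟩ := exists_equiv_of_partial (L := L) hM C
    (fun c => if h : c ∈ C then e (some ⟨c, h⟩) else c)
    (fun c hc c' hc' hcc' => by
      rw [hCval hc, hCval hc', hsome]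
      exact hcc')
    (fun n r x hx => by
      have : (fun k => (fun c => if h : c ∈ C then e (some ⟨c, h⟩) else c) (x k)) =
          fun k => e (some ⟨x k, hx k⟩) := funext fun k => hCval (hx k)
      rw [this, he_rel n r (fun k => some ⟨x k, hx k⟩), hsC n r fun k => ⟨x k, hx k⟩])
  replace hσ : ∀ c (hc : c ∈ C), σ • c = e (some ⟨c, hc⟩) := fun c hc => by
    rw [hσ c hc, hCval hc]
  obtain ⟨b', hb'⟩ : ∃ b', σ • b' = e none := ⟨σ⁻¹ • e none, smul_inv_smul σ _⟩
  have hb'C : b' ∉ C := by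
    intro h
    have := (hσ b' h).symm.trans hb'
    exact Option.some_ne_none _ (he_inj this)
  have hcut : ∀ c ∈ C, c < b' ↔ D c := by
    intro c hc
    rw [← hlt σ, hb', hσ c hc, hnone]
  obtain ⟨r, hr⟩ := exists_equiv_of_partial (L := L) hM (insert b A)
    (fun a => if a = b then b' else a)
    (fun a ha a' ha' haa' => by
      rcases Finset.mem_insert.1 ha with rfl | haA <;>
        rcases Finset.mem_insert.1 ha' with rfl | haA'
      · exact (haa'.false).elim
      · have hne : a' ≠ a := haa'.ne'
        simp only [if_true, hne, if_false]
        refine lt_of_le_of_ne (not_lt.1 fun h => ?_) fun h => hb'C (h ▸ hAC haA')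
        rw [hcut a' (hAC haA'), hA a' haA'] at h
        exact (h.trans haa').false
      · have hne : a ≠ a' := haa'.ne
        simp only [if_true, hne, if_false]
        rw [hcut a (hAC haA), hA a haA]
        exact haa'
      · have hne : a ≠ b := by rintro rfl; exact hb haA
        have hne' : a' ≠ b := by rintro rfl; exact hb haA'
        simpa only [hne, hne', if_false] using haa')
    (fun n r y hy => by
      have hpre : ∀ k, ∃ x : Option C,
          ((∃ a : C, (a : M) ∈ A ∧ x = some a ∧ y k = a) ∨ (x = none ∧ y k = b)) ∧
          σ • (if y k = b then b' else y k) = e x := by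
        intro k
        rcases Finset.mem_insert.1 (hy k) with h | h
        · exact ⟨none, Or.inr ⟨rfl, h⟩, by rw [if_pos h, hb']⟩
        · refine ⟨some ⟨y k, hAC h⟩, Or.inl ⟨_, h, rfl, rfl⟩, ?_⟩
          rw [if_neg (by rintro h'; exact hb (h' ▸ h)), hσ _ (hAC h)]
      choose x hx hxe using hpre
      rw [← hsA n r x y hx, ← he_rel n r x, ← hrel σ]
      simp only [hxe])
  have hrb : r • b = b' := by
    rw [hr b (Finset.mem_insert_self _ _), if_pos rfl]
  refine ⟨r, fun a ha => ?_, by rwa [hrb], by rwa [hrb], ?_⟩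
  · rw [hr a (Finset.mem_insert_of_mem ha), if_neg]
    rintro rfl
    exact hb ha
  · rw [hrb]
    intro n r x hx hE hR
    have hpre : ∀ k, ∃ y : Option C, σ • x k = e y ∧ (y = none ↔ x k = b') ∧
        ∀ c : C, x k = c → y = some c := by
      intro k
      rcases hx k with h | h
      · refine ⟨some ⟨x k, h⟩, hσ _ h, ?_, fun c hc => ?_⟩
        · simp only [reduceCtorEq, false_iff]
          rintro h'
          exact hb'C (h' ▸ h)
        · exact congrArg some (Subtype.ext hc)
      · have h : x k = b' := h
        refine ⟨none, by rw [h, hb'], by simp [h], fun c hc => ?_⟩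
        exact (hb'C (by rw [← h, hc]; exact c.2)).elim
    choose y hy hy' hyc using hpre
    have hset : {k | x k ∈ ({b'} : Set M)} = {k | y k = none} := by
      ext k
      exact (hy' k).symm
    rw [← hrel σ, hset, ← hsδ n r y, ← he_rel n r y]
    · simp only [hy]
    · obtain ⟨k, hk⟩ := hE
      exact ⟨k, (hy' k).2 hk⟩
    · obtain ⟨k, hk⟩ := hR
      rcases hx k with h | h
      · exact ⟨k, ⟨x k, h⟩, fun h' => hk (Or.inl h'), hyc k ⟨x k, h⟩ rfl⟩
      · exact (hk (Or.inr h)).elim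

/-- A structure whose finite substructures are linearly ordered is linearly ordered. -/
theorem model_linearOrderTheory_of_age
    (h : ∀ N ∈ (L.sum Language.order).age M, N ⊨ (L.sum Language.order).linearOrderTheory) :
    M ⊨ (L.sum Language.order).linearOrderTheory := by
  have key : ∀ x y z : M, ∃ S : (L.sum Language.order).Substructure M,
      x ∈ S ∧ y ∈ S ∧ z ∈ S ∧ S ⊨ (L.sum Language.order).linearOrderTheory := by
    intro x y z
    refine ⟨Substructure.closure _ {x, y, z}, Substructure.subset_closure (by simp),
      Substructure.subset_closure (by simp), Substructure.subset_closure (by simp), ?_⟩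
    exact h _ (age.fg_substructure (Substructure.fg_closure (Set.toFinite _)))
  have hcons : ∀ {S : (L.sum Language.order).Substructure M} (a b : S),
      RelMap (leSymb : (L.sum Language.order).Relations 2) ![a, b] ↔
        RelMap (leSymb : (L.sum Language.order).Relations 2) ![(a : M), (b : M)] := by
    intro S a b
    have : ![(a : M), (b : M)] = fun i => ((![a, b] : Fin 2 → S) i : M) := by
      ext i; fin_cases i <;> rfl
    rw [this]
    exact Iff.rfl
  simp only [linearOrderTheory, partialOrderTheory, preorderTheory, Theory.model_insert_iff,
    Relations.realize_total, Relations.realize_antisymmetric, Relations.realize_reflexive,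
    Relations.realize_transitive, Theory.model_singleton_iff] at key ⊢
  refine ⟨⟨fun x y => ?_⟩, ⟨fun x y h1 h2 => ?_⟩, ⟨fun x => ?_⟩, ⟨fun x y z h1 h2 => ?_⟩⟩
  · obtain ⟨S, hx, hy, -, hS, -⟩ := key x y y
    simpa only [hcons] using hS.total ⟨x, hx⟩ ⟨y, hy⟩
  · obtain ⟨S, hx, hy, -, -, hS, -⟩ := key x y y
    exact congrArg Subtype.val (hS.antisymm ⟨x, hx⟩ ⟨y, hy⟩ ((hcons _ _).2 h1) ((hcons _ _).2 h2))
  · obtain ⟨S, hx, -, -, -, -, hS, -⟩ := key x x x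
    exact (hcons _ _).1 (hS.refl ⟨x, hx⟩)
  · obtain ⟨S, hx, hy, hz, -, -, -, hS⟩ := key x y z
    exact (hcons _ _).1 (hS.trans ⟨x, hx⟩ ⟨y, hy⟩ ⟨z, hz⟩ ((hcons _ _).2 h1) ((hcons _ _).2 h2))

end Homogeneous

end FirstOrder.Language

namespace FirstOrder.Language

/-! ### The Baire category criterion -/

section Meagre

open Topology

variable {L : Language.{u, v}} {M : Type w} [L.Structure M]

theorem mem_nhds_aut_iff {g : M ≃[L] M} {s : Set (M ≃[L] M)} :
    s ∈ 𝓝 g ↔ ∃ A : Finset M, ∀ h : M ≃[L] M, (∀ a ∈ A, h • a = g • a) → h ∈ s := by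
  let _ : TopologicalSpace M := ⊥
  have : DiscreteTopology M := ⟨rfl⟩
  rw [show 𝓝 g = Filter.comap (fun f : M ≃[L] M => (f : M → M)) (𝓝 (g : M → M)) from
    nhds_induced _ _, nhds_pi]
  simp only [nhds_discrete]
  constructor
  · rintro ⟨t, ht, hts⟩
    obtain ⟨I, hI, u, hu, hut⟩ := Filter.mem_pi.1 ht
    refine ⟨hI.toFinset, fun h hh => hts (hut fun i hi => ?_)⟩
    have h1 : h i = g i := hh i (hI.mem_toFinset.2 hi)
    have h2 : h i ∈ u i := h1 ▸ Filter.mem_pure.1 (hu i)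
    exact h2
  · rintro ⟨A, hA⟩
    refine ⟨(A : Set M).pi fun a => {g a}, ?_, fun h hh => hA h fun a ha => hh a ha⟩
    exact Filter.mem_pi.2 ⟨A, A.finite_toSet, fun a => {g a}, fun a => Filter.mem_pure.2 rfl, subset_rfl⟩

theorem mem_nhds_aut_pi_iff {ι : Type*} [Finite ι] {g : ι → (M ≃[L] M)} {s : Set (ι → (M ≃[L] M))} :
    s ∈ 𝓝 g ↔ ∃ A : ι → Finset M, ∀ h : ι → (M ≃[L] M),
      (∀ j, ∀ a ∈ A j, h j • a = g j • a) → h ∈ s := by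
  rw [nhds_pi]
  constructor
  · intro hs
    obtain ⟨I, -, t, ht, hts⟩ := Filter.mem_pi.1 hs
    choose A hA using fun j => mem_nhds_aut_iff.1 (ht j)
    exact ⟨A, fun h hh => hts fun j _ => hA j (h j) (hh j)⟩
  · rintro ⟨A, hA⟩
    refine Filter.mem_pi.2 ⟨Set.univ, Set.finite_univ, fun j => {h | ∀ a ∈ A j, h • a = g j • a},
      fun j => mem_nhds_aut_iff.2 ⟨A j, fun _ h => h⟩, fun h hh => hA h fun j => hh j trivial⟩

/-- For a product, split according to the intermediate value `z`; the value of a word at a point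
depends on finitely many values of the generators. -/
theorem isOpen_word_smul_eq {ι : Type*} [Finite ι] (w : FreeGroup ι) :
    ∀ x y : M, IsOpen {g : ι → (M ≃[L] M) | FreeGroup.lift g w • x = y} := by
  have hof : ∀ (j : ι) (x y : M), IsOpen {g : ι → (M ≃[L] M) | g j • x = y} := by
    intro j x y
    rw [isOpen_iff_mem_nhds]
    intro g hg
    refine mem_nhds_aut_pi_iff.2 ⟨fun _ => {x}, fun h hh => ?_⟩
    exact (hh j x (Finset.mem_singleton_self x)).trans hg
  induction w using FreeGroup.induction_on with
  | C1 => intro x y; simp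
  | of j => simpa using hof j
  | inv_of j _ =>
    intro x y
    simp only [map_inv, FreeGroup.lift_apply_of, inv_smul_eq_iff]
    simpa only [eq_comm] using hof j y x
  | mul u v hu hv =>
    intro x y
    have : {g : ι → (M ≃[L] M) | FreeGroup.lift g (u * v) • x = y} =
        ⋃ z : M, {g | FreeGroup.lift g v • x = z} ∩ {g | FreeGroup.lift g u • z = y} := by
      ext g
      simp [mul_smul]
    rw [this]
    exact isOpen_iUnion fun z => (hv x z).inter (hu z y)

theorem isClosed_word_smul_eq {ι : Type*} [Finite ι] (w : FreeGroup ι) (x y : M) :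
    IsClosed {g : ι → (M ≃[L] M) | FreeGroup.lift g w • x = y} := by
  rw [← isOpen_compl_iff]
  have : {g : ι → (M ≃[L] M) | FreeGroup.lift g w • x = y}ᶜ =
      ⋃ z : {z // z ≠ y}, {g | FreeGroup.lift g w • x = z} := by
    ext g
    simp
  rw [this]
  exact isOpen_iUnion fun z => isOpen_word_smul_eq w x z

theorem mem_topologicalSimilarityClass_symm {G : Type*} [Group G] [TopologicalSpace G] {n : ℕ}
    {f g : Fin n → G} (h : g ∈ topologicalSimilarityClass f) :
    f ∈ topologicalSimilarityClass g := by
  obtain ⟨φ, hφ⟩ := h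
  refine ⟨φ.symm, fun i => ?_⟩
  have h1 : φ ⟨f i, Subgroup.subset_closure (Set.mem_range_self i)⟩ =
      ⟨g i, Subgroup.subset_closure (Set.mem_range_self i)⟩ := Subtype.ext (hφ i)
  rw [← h1]
  exact congrArg Subtype.val (φ.symm_apply_apply _)

/-- For similar tuples, words that fix sufficiently many points under the one fix given points under
the other. -/
theorem exists_finset_of_similar {n : ℕ} {f g : Fin n → (M ≃[L] M)}
    (h : g ∈ topologicalSimilarityClass f) (F' : Finset M) :
    ∃ F : Finset M, ∀ w : FreeGroup (Fin n), (∀ x ∈ F, FreeGroup.lift f w • x = x) →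
      ∀ x ∈ F', FreeGroup.lift g w • x = x := by
  obtain ⟨φ, hφ⟩ := h
  let ψ : FreeGroup (Fin n) →* Subgroup.closure (Set.range f) :=
    FreeGroup.lift fun i => ⟨f i, Subgroup.subset_closure (Set.mem_range_self i)⟩
  have hψ : ∀ w, (ψ w : M ≃[L] M) = FreeGroup.lift f w := by
    intro w
    have : (Subgroup.subtype _).comp ψ = FreeGroup.lift f := by
      ext1 i
      simp [ψ]
    rw [← this]; rfl
  have hφψ : ∀ w, (φ (ψ w) : M ≃[L] M) = FreeGroup.lift g w := by
    intro w
    have : ((Subgroup.subtype _).comp φ.toMulEquiv.toMonoidHom).comp ψ = FreeGroup.lift g := by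
      ext1 i
      have h1 : ψ (FreeGroup.of i) = ⟨f i, Subgroup.subset_closure (Set.mem_range_self i)⟩ := by
        simp [ψ]
      simp only [MonoidHom.comp_apply, FreeGroup.lift_apply_of, h1]
      exact hφ i
    rw [← this]; rfl
  have hU : {k : Subgroup.closure (Set.range g) | ∀ x ∈ F', (k : M ≃[L] M) • x = x} ∈
      𝓝 (φ 1) := by
    rw [map_one, nhds_subtype_eq_comap]
    refine ⟨{k | ∀ x ∈ F', k • x = x}, mem_nhds_aut_iff.2 ⟨F', fun k hk x hx => ?_⟩,
      fun _ h => h⟩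
    rw [hk x hx]
    exact one_smul _ x
  have hV := φ.continuous.continuousAt.preimage_mem_nhds hU
  rw [nhds_subtype_eq_comap] at hV
  obtain ⟨t, ht, hts⟩ := hV
  obtain ⟨F, hF⟩ := mem_nhds_aut_iff.1 ht
  refine ⟨F, fun w hw x hx => ?_⟩
  have h1 : ψ w ∈ ((↑) : Subgroup.closure (Set.range f) → (M ≃[L] M)) ⁻¹' t := by
    refine hF _ fun a ha => ?_
    rw [hψ, hw a ha]
    exact (one_smul _ a).symm
  have h2 : (φ (ψ w) : M ≃[L] M) • x = x := hts h1 x hx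
  rwa [hφψ] at h2

/-- Two-dimensional similarity classes are meager if words can simultaneously be trivialized on a
finite set and be made nontrivial at a point. -/
theorem isMeagre_topologicalSimilarityClass [Countable M]
    (hmove : ∀ A : Finset M, ∃ (g : M ≃[L] M) (x : M), (∀ a ∈ A, g • a = a) ∧ g • x ≠ x)
    (hword : ∀ (f : Fin 2 → (M ≃[L] M)) (A : Fin 2 → Finset M) (F : Finset M) (x₀ : M),
      f 0 • x₀ ≠ x₀ → ∃ (w : FreeGroup (Fin 2)) (f' f'' : Fin 2 → (M ≃[L] M)),
        (∀ j, ∀ a ∈ A j, f' j • a = f j • a) ∧ (∀ j, ∀ a ∈ A j, f'' j • a = f j • a) ∧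
        (∀ x ∈ F, FreeGroup.lift f' w • x = x) ∧ FreeGroup.lift f'' w • x₀ ≠ x₀)
    (f : Fin 2 → (M ≃[L] M)) : IsMeagre (topologicalSimilarityClass f) := by
  have hgen : ∀ (x y : M), IsClosed {g : Fin 2 → (M ≃[L] M) | g 0 • x = y} := fun x y => by
    simpa using isClosed_word_smul_eq (L := L) (FreeGroup.of (0 : Fin 2)) x y
  -- `p.2.1` and `p.2.2` record moduli of continuity at the identity for the isomorphism and its
  -- inverse; countability of `M` makes the family countable.
  set S : M × Finset M × Finset M → Set (Fin 2 → (M ≃[L] M)) := fun p =>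
    {g | g 0 • p.1 ≠ p.1 ∧
      (∀ w, (∀ y ∈ p.2.1, FreeGroup.lift f w • y = y) → FreeGroup.lift g w • p.1 = p.1) ∧
      ∀ w, (∀ y ∈ p.2.2, FreeGroup.lift g w • y = y) →
        ∀ y ∈ p.2.1, FreeGroup.lift f w • y = y} with hS
  set T : Set (Fin 2 → (M ≃[L] M)) := {g | ∀ x : M, g 0 • x = x} with hT
  have hTn : IsNowhereDense T := by
    have hclosed : IsClosed T := by
      have : T = ⋂ x : M, {g | g 0 • x = x} := by ext; simp [hT]
      rw [this]
      exact isClosed_iInter fun x => hgen x x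
    rw [hclosed.isNowhereDense_iff, Set.eq_empty_iff_forall_notMem]
    intro g hg
    obtain ⟨A, hA⟩ := mem_nhds_aut_pi_iff.1 (mem_interior_iff_mem_nhds.1 hg)
    obtain ⟨k, x, hk, hkx⟩ := hmove (A 0)
    have hgT : g ∈ T := hA g fun _ _ _ => rfl
    refine hkx (hA (Function.update g 0 k) (fun j a ha => ?_) x)
    rcases eq_or_ne j 0 with rfl | hj
    · rw [Function.update_self, hk a ha, hgT a]
    · rw [Function.update_of_ne hj]
  have hSn : ∀ p, IsNowhereDense (S p) := by
    rintro ⟨x, F, F'⟩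
    have hclosed : IsClosed (S (x, F, F')) := by
      simp only [hS]
      refine IsClosed.inter ?_ (IsClosed.inter ?_ ?_)
      · have : IsOpen {g : Fin 2 → (M ≃[L] M) | g 0 • x = x} := by
          simpa using isOpen_word_smul_eq (L := L) (FreeGroup.of (0 : Fin 2)) x x
        exact this.isClosed_compl
      · have h : IsClosed (⋂ (w) (_ : ∀ y ∈ F, FreeGroup.lift f w • y = y),
            {g : Fin 2 → (M ≃[L] M) | FreeGroup.lift g w • x = x}) :=
          isClosed_iInter fun w => isClosed_iInter fun _ => isClosed_word_smul_eq w x x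
        refine cast (congrArg IsClosed (Set.ext fun g => ?_)) h
        simp only [Set.mem_iInter]
        rfl
      · have h : IsClosed (⋂ (w) (_ : ¬ ∀ y ∈ F, FreeGroup.lift f w • y = y),
            (⋂ y ∈ F', {g : Fin 2 → (M ≃[L] M) | FreeGroup.lift g w • y = y})ᶜ) :=
          isClosed_iInter fun w => isClosed_iInter fun _ => isClosed_compl_iff.2
            (isOpen_biInter_finset fun y _ => isOpen_word_smul_eq w y y)
        refine cast (congrArg IsClosed (Set.ext fun g => ?_)) h
        simp only [Set.mem_iInter, Set.mem_compl_iff]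
        exact forall_congr' fun w => not_imp_not
    rw [hclosed.isNowhereDense_iff, Set.eq_empty_iff_forall_notMem]
    intro g hg
    obtain ⟨A, hA⟩ := mem_nhds_aut_pi_iff.1 (mem_interior_iff_mem_nhds.1 hg)
    have hgS : g ∈ S (x, F, F') := hA g fun _ _ _ => rfl
    obtain ⟨w, f', f'', h1, h2, h3, h4⟩ := hword g A F' x hgS.1
    -- `w` fixes `F'` under `f'`, hence `F` under the fixed tuple `f`, hence `x` under `f''`,
    -- against the choice of `f''`.
    exact h4 ((hA f'' h2).2.1 w ((hA f' h1).2.2 w h3))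
  refine (hTn.isMeagre.union (isMeagre_iUnion fun p => (hSn p).isMeagre)).mono ?_
  intro g hg
  by_cases hgT : g ∈ T
  · exact Or.inl hgT
  · simp only [hT, Set.mem_ofPred_eq, not_forall] at hgT
    obtain ⟨x, hx⟩ := hgT
    obtain ⟨F, hF⟩ := exists_finset_of_similar hg {x}
    obtain ⟨F', hF'⟩ := exists_finset_of_similar (mem_topologicalSimilarityClass_symm hg) F
    exact Or.inr (Set.mem_iUnion.2 ⟨(x, F, F'), hx,
      fun w hw => hF w hw x (Finset.mem_singleton_self x), hF'⟩)

end Meagre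

end FirstOrder.Language

namespace FirstOrder.Language

/-! ### Fraïssé limits: free amalgamation and tournaments -/

section Limits

open Structure

variable {L : Language.{u, v}} {M : Type w} [(L.sum Language.order).Structure M]

open Classical in
/-- In an ordered ultrahomogeneous structure with generic one-point extensions, two-dimensional
similarity classes are meager. -/
theorem isMeagre_topologicalSimilarityClass_of_hasGenericExtensions [L.IsRelational]
    [Countable M] [Nonempty M] {K : Set (Bundled.{w} L.Structure)}
    {δ : ∀ n, L.Relations n → Set (Fin n) → Prop}
    (hM : (L.sum Language.order).IsUltrahomogeneous M)
    (hage : (L.sum Language.order).age M = orderExpansion K)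
    (hK : HasGenericExtensions K M δ)
    (hδ : ∀ (n : ℕ) (r : L.Relations n) (T T' : Set (Fin n)), T.Nonempty → T'.Nonempty →
      Disjoint T T' → (∃ k, k ∉ T ∪ T') → (δ n r T ↔ δ n r (T ∪ T')))
    (f : Fin 2 → (M ≃[L.sum Language.order] M)) : IsMeagre (topologicalSimilarityClass f) := by
  have : M ⊨ (L.sum Language.order).linearOrderTheory :=
    model_linearOrderTheory_of_age fun N hN => (hage ▸ hN : N ∈ orderExpansion K).2
  let _ : LinearOrder M := (L.sum Language.order).linearOrderOfModels M
  have : (L.sum Language.order).OrderedStructure M :=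
    inferInstanceAs (@OrderedStructure _ M _ ((L.sum Language.order).leOfStructure M) _)
  have hG := genericOrderedAction hM hage.ge hK hδ
  refine isMeagre_topologicalSimilarityClass (fun A => ?_)
    (fun f A F x₀ hx₀ => hG.exists_word f A F hx₀) f
  -- Any point has a translate outside `A`, and that translate can be moved with `A` fixed.
  obtain ⟨g, -, hg, -⟩ := hG.exists_extension 1 (A := ∅) (C := A) (b := Classical.arbitrary M)
    (fun _ => False) (by simp) (by simp) (by simp) (by simp)
  set b := g • Classical.arbitrary M
  obtain ⟨k, hk, hkb, -⟩ := hG.exists_extension_high 1 (A := A) (C := insert b A) (b := b) hg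
    (fun a ha => by simp [ha])
  exact ⟨k, b, fun a ha => by rw [hk a ha, one_smul],
    fun h => hkb (by rw [h]; exact Finset.mem_insert_self _ _)⟩

/-- Amalgamate `A ∪ {b}` and `C` freely over `A`: `b` is not identified with a point of `C` and is
in no relation with a point of `C \ A`, so `δ` is constantly false. -/
theorem hasGenericExtensions_of_freeAmalgamation [L.IsRelational]
    (hfree : FreeAmalgamation (reductClass ((L.sum Language.order).age M))) :
    HasGenericExtensions (reductClass ((L.sum Language.order).age M)) M
      (fun _ _ _ => False) := by
  classical
  intro A C b hAC hb
  let N : Finset M → Bundled.{w} L.Structure := fun X =>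
    orderReduct ⟨X, pullbackStructure (L := L.sum Language.order) (Subtype.val : X → M)⟩
  have hN : ∀ X, N X ∈ reductClass ((L.sum Language.order).age M) := fun X =>
    ⟨_, pullbackStructure_mem_age Subtype.val_injective, rfl⟩
  let inc : ∀ {X Y : Finset M}, X ⊆ Y → (N X ↪[L] N Y) := fun {X Y} h =>
    { toFun := fun a : X => (⟨a, h a.2⟩ : Y)
      inj' := fun a a' haa' => Subtype.ext (congrArg (fun z : Y => (z : M)) haa')
      map_fun' := fun {n} f => isEmptyElim f
      map_rel' := fun r x => Iff.rfl }
  obtain ⟨D, i, j, ⟨D', ⟨-, ⟨e⟩⟩, hD⟩, hij, -, hinter, hrel⟩ :=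
    hfree (N A) (N (insert b A)) (N C) (inc (Finset.subset_insert b A)) (inc hAC)
      (hN _) (hN _) (hN _)
  subst hD
  have hij' : ∀ (a : M) (ha : a ∈ A), i (⟨a, Finset.mem_insert_of_mem ha⟩ : (insert b A : Finset M)) =
      j (⟨a, hAC ha⟩ : C) := fun a ha => DFunLike.congr_fun hij (⟨a, ha⟩ : A)
  have hrange : ∀ d, d ∈ Set.range (i.comp (inc (Finset.subset_insert b A))) ↔
      ∃ (a : M) (ha : a ∈ A), j (⟨a, hAC ha⟩ : C) = d := by
    intro d
    constructor
    · rintro ⟨a, rfl⟩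
      exact ⟨_, a.2, (hij' _ a.2).symm⟩
    · rintro ⟨a, ha, rfl⟩
      exact ⟨(⟨a, ha⟩ : A), hij' a ha⟩
  set d := i (⟨b, Finset.mem_insert_self b A⟩ : (insert b A : Finset M)) with hd
  have hdA : d ∉ Set.range (i.comp (inc (Finset.subset_insert b A))) := by
    rintro ⟨(a : A), ha⟩
    have h : (a : M) = b :=
      congrArg (fun z : (insert b A : Finset M) => (z : M)) (i.injective ha)
    exact hb (h ▸ a.2)
  have hdj : ∀ c : C, j c ≠ d := fun c hc => hdA (hinter ▸ ⟨⟨_, rfl⟩, ⟨c, hc⟩⟩)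
  let ψ : Option C → D' := fun x => match x with
    | some c => j c
    | none => d
  have hψ : Function.Injective ψ := by
    rintro (_ | c) (_ | c') h
    · rfl
    · exact (hdj c' h.symm).elim
    · exact (hdj c h).elim
    · exact congrArg some (j.injective h)
  have hs := pullbackStructure_mem_age (L := L.sum Language.order) (φ := fun x => e (ψ x))
    (e.injective.comp hψ)
  have hrelD : ∀ n (r : L.Relations n) (x : Fin n → Option C),
      (orderReduct ⟨Option C, pullbackStructure (L := L.sum Language.order)
        (fun x => e (ψ x))⟩).str.RelMap r x ↔
          (orderReduct D').str.RelMap r (fun k => ψ (x k)) := fun n r x =>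
    StrongHomClass.map_rel e (Sum.inl r : (L.sum Language.order).Relations n) fun k => ψ (x k)
  refine ⟨(orderReduct ⟨Option C, pullbackStructure (L := L.sum Language.order)
    (fun x => e (ψ x))⟩).str, ⟨_, hs, rfl⟩, fun n r x => ?_, fun n r x y hxy => ?_,
    fun n r x ⟨k, hk⟩ ⟨l, c, hc, hl⟩ => ?_⟩
  · exact (hrelD n r _).trans (j.map_rel r x)
  · have hz : ∀ k, ∃ z : (insert b A : Finset M), (z : M) = y k ∧ i z = ψ (x k) := by
      intro k
      rcases hxy k with ⟨a, ha, h, h'⟩ | ⟨h, h'⟩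
      · exact ⟨⟨a, Finset.mem_insert_of_mem ha⟩, h'.symm, by rw [h]; exact hij' a ha⟩
      · exact ⟨⟨b, Finset.mem_insert_self b A⟩, h'.symm, by rw [h]⟩
    choose z hzy hzx using hz
    refine (hrelD n r x).trans ?_
    obtain rfl : y = fun k => (z k : M) := funext fun k => (hzy k).symm
    simp only [← hzx]
    exact i.map_rel r z
  · have hjc : j c ∉ Set.range (i.comp (inc (Finset.subset_insert b A))) := by
      intro h
      obtain ⟨a, ha, h⟩ := (hrange _).1 h
      have h' : a = c := congrArg (fun z : C => (z : M)) (j.injective h)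
      exact hc (h' ▸ ha)
    refine iff_of_false (fun h => hrel n r _ ((hrelD n r x).1 h) ⟨⟨k, ?_⟩, l, ?_⟩) id
    · rw [hk]
      exact ⟨⟨_, rfl⟩, hdA⟩
    · rw [hl]
      exact ⟨⟨c, rfl⟩, hjc⟩

end Limits

section Tournament

open Structure

variable {M : Type w} [(tournament.sum Language.order).Structure M]

/-- The generic type over a finite ordered tournament: the new point dominates. -/
def tournamentGeneric (n : ℕ) (r : tournament.Relations n) (T : Set (Fin n)) : Prop :=
  match n, r, T with
  | _, TournamentRel.arrow, T => (0 : Fin 2) ∈ T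

/-- The arrows of an ordered tournament. -/
def arrow (a b : M) : Prop := reductRel tournament M 2 TournamentRel.arrow ![a, b]

theorem reductRel_arrow (x : Fin 2 → M) :
    reductRel tournament M 2 TournamentRel.arrow x ↔ arrow (x 0) (x 1) := by
  rw [arrow, show ![x 0, x 1] = x from by ext i; fin_cases i <;> rfl]

theorem arrow_of_age
    (hage : (tournament.sum Language.order).age M ⊆ orderExpansion finiteTournaments) (a b : M) :
    ¬ arrow a a ∧ (a ≠ b → Xor (arrow a b) (arrow b a)) := by
  classical
  obtain ⟨⟨-, h1, h2⟩, -⟩ := hage (pullbackStructure_mem_age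
    (X := ({a, b} : Finset M)) Subtype.val_injective)
  have key : ∀ x y : ({a, b} : Finset M), (orderReduct ⟨({a, b} : Finset M),
      pullbackStructure (L := tournament.sum Language.order)
        (Subtype.val : ({a, b} : Finset M) → M)⟩).str.RelMap TournamentRel.arrow ![x, y] ↔
      arrow (x : M) y := fun x y => reductRel_arrow (fun k => ((![x, y] k : ({a, b} : Finset M)) : M))
  constructor
  · rw [← key ⟨a, by simp⟩ ⟨a, by simp⟩]
    exact h1 _
  · intro hab
    rw [← key ⟨a, by simp⟩ ⟨b, by simp⟩, ← key ⟨b, by simp⟩ ⟨a, by simp⟩]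
    exact h2 _ _ fun h => hab (congrArg Subtype.val h)

/-- Two points of a tournament must be joined, so the relations cannot be left out; directing all
arrows from the new point to `C \ A` is uniform and always gives a tournament. -/
theorem hasGenericExtensions_finiteTournaments
    (hage : (tournament.sum Language.order).age M ⊆ orderExpansion finiteTournaments) :
    HasGenericExtensions finiteTournaments M tournamentGeneric := by
  intro A C b hAC hb
  have hirr : ∀ a : M, ¬ arrow a a := fun a => (arrow_of_age hage a a).1
  have hxor : ∀ a b : M, a ≠ b → Xor (arrow a b) (arrow b a) := fun a b =>
    (arrow_of_age hage a b).2
  let E : Option C → Option C → Prop := fun x y => match x, y with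
    | some c, some c' => arrow (c : M) (c' : M)
    | some c, none => (c : M) ∈ A ∧ arrow (c : M) b
    | none, some c => (c : M) ∈ A → arrow b (c : M)
    | none, none => False
  let s : tournament.Structure (Option C) :=
    { funMap := fun f => isEmptyElim f
      RelMap := fun {n} r => match n, r with
        | _, TournamentRel.arrow => fun x => E (x 0) (x 1) }
  refine ⟨s, ⟨inferInstance, ?_, ?_⟩, ?_, ?_, ?_⟩
  · rintro (_ | c)
    · exact id
    · exact hirr c
  · have hmix : ∀ c : C, Xor (E (some c) none) (E none (some c)) := by
      intro c
      by_cases hc : (c : M) ∈ A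
      · have := hxor c b (by rintro h; exact hb (h ▸ hc))
        simpa [E, hc] using this
      · exact Or.inr ⟨fun h => (hc h).elim, fun h => hc h.1⟩
    rintro (_ | c) (_ | c') hne
    · exact (hne rfl).elim
    · exact (hmix c').symm
    · exact hmix c
    · exact hxor c c' fun h => hne (congrArg some (Subtype.ext h))
  · rintro n ⟨⟩ x
    exact (reductRel_arrow fun k => (x k : M)).symm
  · rintro n ⟨⟩ x y hxy
    rw [reductRel_arrow]
    change E (x 0) (x 1) ↔ _
    rcases hxy 0 with ⟨a, ha, h0, h0'⟩ | ⟨h0, h0'⟩ <;>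
      rcases hxy 1 with ⟨a', ha', h1, h1'⟩ | ⟨h1, h1'⟩ <;>
      rw [h0, h0', h1, h1']
    · exact ⟨fun h => h.2, fun h => ⟨ha, h⟩⟩
    · exact ⟨fun h => h ha', fun h _ => h⟩
    · exact iff_of_false id (hirr b)
  · rintro n ⟨⟩ x ⟨k, hk⟩ ⟨l, c, hc, hl⟩
    change E (x 0) (x 1) ↔ x 0 = none
    have hkl : k ≠ l := by rintro rfl; rw [hk] at hl; exact Option.some_ne_none _ hl.symm
    have hkl' : (k = 0 ∧ l = 1) ∨ (k = 1 ∧ l = 0) := by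
      clear hk hl
      revert k l
      decide
    rcases hkl' with ⟨rfl, rfl⟩ | ⟨rfl, rfl⟩
    · rw [hk, hl]
      exact iff_of_true (fun h => (hc h).elim) rfl
    · rw [hk, hl]
      exact iff_of_false (fun h => hc h.1) (Option.some_ne_none c)

theorem nonempty_of_orderExpansion_finiteTournaments_subset_age
    (hage : orderExpansion finiteTournaments ⊆ (tournament.sum Language.order).age M) :
    Nonempty M := by
  let s : tournament.Structure PUnit.{w + 1} :=
    { funMap := fun f => isEmptyElim f
      RelMap := fun _ _ => False }
  let _ : Language.order.Structure PUnit.{w + 1} := orderStructure _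
  have : (tournament.sum Language.order).OrderedStructure PUnit.{w + 1} := ⟨fun x => by
    have : x = ![x 0, x 1] := by ext i
    rw [this]
    exact Iff.rfl⟩
  obtain ⟨-, ⟨e⟩⟩ := hage (a := ⟨PUnit.{w + 1}, inferInstance⟩)
    ⟨⟨inferInstanceAs (Finite PUnit.{w + 1}), fun _ => id, fun x y h => (h rfl).elim⟩,
      model_linearOrder⟩
  exact ⟨e PUnit.unit⟩

end Tournament

end FirstOrder.Language

theorem mainTheorem7 :
    (∀ (L : FirstOrder.Language.{u, v}) [L.IsRelational]
        (F : Set (Bundled.{w} (L.sum FirstOrder.Language.order).Structure))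
        (M : Type w) [(L.sum FirstOrder.Language.order).Structure M] [Countable M],
        FirstOrder.Language.IsFraisse F →
        (∃ A ∈ F, Nonempty A) →
        FirstOrder.Language.IsFullOrderExpansion F →
        FirstOrder.Language.FreeAmalgamation (FirstOrder.Language.reductClass F) →
        FirstOrder.Language.IsFraisseLimit F M →
        ∀ f : Fin 2 → (M ≃[L.sum FirstOrder.Language.order] M),
          IsMeagre (topologicalSimilarityClass f)) ∧
    (∀ (M : Type w)
        [(FirstOrder.Language.tournament.sum FirstOrder.Language.order).Structure M]
        [Countable M],
        FirstOrder.Language.IsFraisseLimit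
          (FirstOrder.Language.orderExpansion FirstOrder.Language.finiteTournaments) M →
        ∀ f : Fin 2 → (M ≃[FirstOrder.Language.tournament.sum FirstOrder.Language.order] M),
          IsMeagre (topologicalSimilarityClass f)) := by
  refine ⟨fun L _ F M _ _ _ hne hfull hfree hM f => ?_, fun M _ _ hM f => ?_⟩
  · have hage := hM.age
    subst hage
    obtain ⟨A, ⟨-, ⟨e⟩⟩, ⟨a⟩⟩ := hne
    have : Nonempty M := ⟨e a⟩
    exact FirstOrder.Language.isMeagre_topologicalSimilarityClass_of_hasGenericExtensions
      hM.ultrahomogeneous hfull (FirstOrder.Language.hasGenericExtensions_of_freeAmalgamation hfree)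
      (fun _ _ _ _ _ _ _ _ => Iff.rfl) f
  · have : Nonempty M :=
      FirstOrder.Language.nonempty_of_orderExpansion_finiteTournaments_subset_age hM.age.ge
    refine FirstOrder.Language.isMeagre_topologicalSimilarityClass_of_hasGenericExtensions
      hM.ultrahomogeneous hM.age
      (FirstOrder.Language.hasGenericExtensions_finiteTournaments hM.age.le) ?_ f
    -- The compatibility of `δ` with unions is vacuous for a binary relation: it would need three
    -- distinct coordinates.
    rintro n ⟨⟩ T T' ⟨k, hk⟩ ⟨l, hl⟩ hTT' ⟨m, hm⟩
    have hkl : k ≠ l := fun h => Set.disjoint_left.1 hTT' hk (h ▸ hl)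
    have hkm : k ≠ m := fun h => hm (Or.inl (h ▸ hk))
    have hlm : l ≠ m := fun h => hm (Or.inr (h ▸ hl))
    exact absurd hlm (by clear hk hl hm hlm; revert k l m; decide)
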